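/- Let $\sigma=\sigma(n)$ be a function with $\sigma(n)\in o\left(\frac{\log n}{(\log\log n)^2}\right)$. For a sequence $S[1..n]$ of positive integers that are at most $\sigma(n)$, let $S.\mathsf{search}(j)$ be the largest $i\in\{0,\dots,n\}$ with $S[1]+\cdots+S[i]\le j$, and let $\mathrm{FV}(S)$ be Ferragina and Venturini's representation of $S$ as a string over the alphabet $\{1,\dots,\sigma\}$: $S$ is cut into blocks of $b=\lfloor\frac12\log_\sigma n\rfloor$ characters (taking $\log_2$ if $\sigma=1$, and at least one character per block; the last block is padded), the distinct blocks are sorted by decreasing frequency, the block of rank $r$ is replaced by the $r$th bit string in the order $\varepsilon,0,1,00,01,10,11,000,\dots$, and the representation consists of the concatenation of these codewords, a table of their starting positions with two levels (absolute positions of superblocks of $\Theta(\log n)$ blocks, and positions of blocks relative to their superblocks), and a table listing the distinct blocks by rank. We can add $o(n)$ bits to $\mathrm{FV}(S)$ and support $\mathsf{search}$ in constant time on a word RAM. Precisely, there are a single word-RAM program $P$ and a constant $T$ such that for every such function $\sigma$ there is a function $e(n)\in o(n)$ such that, for all sufficiently large $n$ and every sequence $S$ of $n$ integers from $\{1,\dots,\sigma(n)\}$,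 there is a string of at most $e(n)$ extra bits such that, for every word length $w\ge 2\lg n$ and every integer $0\le j<2^w$, the program $P$, started with the argument $j$ and with the extra bits and $\mathrm{FV}(S)$ as its read-only memory, halts with the output $S.\mathsf{search}(j)$ after at most $T$ instructions. (The word RAM has arithmetic, bitwise and shift operations on words of $w$ bits, conditional jumps, a fixed finite number of registers, and an instruction that reads any $w$ consecutive bits of the memory, all at unit cost.) -/

import Mathlib

open Filter Asymptotics Topology

/-! ## Search queries on partial sums -/

namespace PartialSums

/-- `search S j` is the largest `i ≤ |S|` such that the sum of the first `i` entries of `S`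
is at most `j` (the value `i = 0` always qualifies). -/
def search (S : List ℕ) (j : ℕ) : ℕ :=
  Nat.findGreatest (fun i => (S.take i).sum ≤ j) S.length

end PartialSums

/-! ## The word RAM

Words have `w` bits. The data structure is a read-only string of bits, and one instruction reads
any `w` consecutive bits of it. A query algorithm has registers only (finitely many, since a program
is a finite list), so that the space it uses in addition to the data structure is `O(1)` words. -/

namespace WordRAM

/-- The arithmetic and bitwise operations on words. -/
inductive Op
  | add | sub | mul | div | mod | and | or | xor | shl | shr

/-- Their values on words of `w` bits: arithmetic is modulo `2 ^ w`; a quotient by zero is zero. -/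
def Op.eval (w : ℕ) : Op → ℕ → ℕ → ℕ
  | .add, x, y => (x + y) % 2 ^ w
  | .sub, x, y => (x + (2 ^ w - y)) % 2 ^ w
  | .mul, x, y => (x * y) % 2 ^ w
  | .div, x, y => x / y
  | .mod, x, y => x % y
  | .and, x, y => x &&& y
  | .or, x, y => x ||| y
  | .xor, x, y => x ^^^ y
  | .shl, x, y => (x <<< y) % 2 ^ w
  | .shr, x, y => x >>> y

/-- Instructions; registers, constants and jump targets are natural numbers. -/
inductive Instr
  /-- `const d c`: register `d` receives the constant `c` (modulo `2 ^ w`). -/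
  | const (d c : ℕ)
  /-- `op o d a b`: register `d` receives the value of `o` on the registers `a` and `b`. -/
  | op (o : Op) (d a b : ℕ)
  /-- `load d a`: register `d` receives the `w` consecutive bits of the memory that start at the bit
  address held by register `a`. -/
  | load (d a : ℕ)
  /-- `jlt a b t`: jump to instruction `t` if register `a` is smaller than register `b`. -/
  | jlt (a b t : ℕ)

/-- A program is a finite list of instructions, which are numbered from `0`. -/
abbrev Program := List Instr

/-- The `w` bits of the memory from bit address `a` on, least significant bit first;
beyond its end the memory reads as zeros. -/
def readWord (w : ℕ) (mem : List Bool) (a : ℕ) : ℕ :=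
  Nat.ofBits fun t : Fin w => mem.getD (a + t) false

/-- A configuration: the number of the next instruction and the contents of the registers. -/
structure State where
  pc : ℕ
  reg : ℕ → ℕ

/-- The effect of one instruction. -/
def Instr.exec (w : ℕ) (mem : List Bool) (s : State) : Instr → State
  | .const d c => ⟨s.pc + 1, Function.update s.reg d (c % 2 ^ w)⟩
  | .op o d a b => ⟨s.pc + 1, Function.update s.reg d (o.eval w (s.reg a) (s.reg b))⟩
  | .load d a => ⟨s.pc + 1, Function.update s.reg d (readWord w mem (s.reg a))⟩
  | .jlt a b t => ⟨if s.reg a < s.reg b then t else s.pc + 1, s.reg⟩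

/-- One step of the machine. It has halted when there is no instruction with number `s.pc`. -/
def step (w : ℕ) (mem : List Bool) (P : Program) (s : State) : State :=
  match P[s.pc]? with
  | some i => i.exec w mem s
  | none => s

/-- At the start register `0` holds the argument of the query and all other registers hold zero. -/
def init (x : ℕ) : State := ⟨0, fun r => if r = 0 then x else 0⟩

/-- On words of `w` bits and with the memory `mem`, the program `P` started with the argument `x`
halts after at most `T` instructions with the value `y` in register `0`. -/
def Computes (w : ℕ) (mem : List Bool) (P : Program) (x T y : ℕ) : Prop :=
  ∃ t ≤ T, P[((step w mem P)^[t] (init x)).pc]? = none ∧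
    ((step w mem P)^[t] (init x)).reg 0 = y

end WordRAM

/-! ## Ferragina and Venturini's representation of a string

The string `S` over the alphabet `{1, …, σ}` is cut into blocks of `b = ⌊(log_σ n) / 2⌋` characters.
The distinct blocks are sorted by decreasing frequency, and each block is replaced by the codeword
of its rank, where the codewords are all the bit strings in the order of their lengths. The
codewords are not prefix-free, so that their starting positions in the concatenation are kept in
a table with two levels; a further table translates ranks back into blocks. -/

namespace FerraginaVenturini

/-- The integer `x` as a field of `width` bits, least significant bit first. -/
def field (width x : ℕ) : List Bool :=
  (List.range width).map fun t => x.testBit t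

/-- The block length `⌊(log_σ n) / 2⌋`, where a unary alphabet is treated as a binary one;
it is at least `1`. -/
def blockLen (σ n : ℕ) : ℕ := max 1 (Nat.log (max 2 σ ^ 2) n)

/-- The number `⌈n / b⌉` of blocks. -/
def numBlocks (σ n : ℕ) : ℕ := (n + blockLen σ n - 1) / blockLen σ n

/-- The `i`th block of `S`, counted from `0`; the last block is filled up with the character `1`. -/
def block (σ : ℕ) (S : List ℕ) (i : ℕ) : List ℕ :=
  (List.range (blockLen σ S.length)).map fun t => S.getD (i * blockLen σ S.length + t) 1

/-- The sequence of the blocks of `S`. -/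
def blocks (σ : ℕ) (S : List ℕ) : List (List ℕ) :=
  (List.range (numBlocks σ S.length)).map (block σ S)

/-- The distinct blocks of `S` in the order of decreasing frequency. -/
def sortedBlocks (σ : ℕ) (S : List ℕ) : List (List ℕ) :=
  (blocks σ S).dedup.mergeSort fun x y => decide ((blocks σ S).count y ≤ (blocks σ S).count x)

/-- The codeword of rank `r`: the `r`th element of `ε, 0, 1, 00, 01, 10, 11, 000, …`, counted from
`0`, that is the binary representation of `r + 1` without its leading `1`. It is written with the
least significant bit first. -/
def codeword (r : ℕ) : List Bool := (Nat.bits (r + 1)).dropLast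

/-- The codeword of the `i`th block of `S`. -/
def blockCode (σ : ℕ) (S : List ℕ) (i : ℕ) : List Bool :=
  codeword ((sortedBlocks σ S).idxOf (block σ S i))

/-- The starting position of the codeword of the `i`th block in the concatenation of all the
codewords; for `i` the number of blocks it is the length of the concatenation. -/
def start (σ : ℕ) (S : List ℕ) (i : ℕ) : ℕ :=
  ((List.range i).map fun l => (blockCode σ S l).length).sum

/-- The concatenation of the codewords of all the blocks. -/
def codes (σ : ℕ) (S : List ℕ) : List Bool :=
  (List.range (numBlocks σ S.length)).flatMap (blockCode σ S)

/-- The number of blocks in a superblock, `⌊lg n⌋ + 1`. -/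
def superLen (n : ℕ) : ℕ := Nat.size n

/-- The starting positions of the superblocks, in `O(log n)` bits each. -/
def superTable (σ : ℕ) (S : List ℕ) : List Bool :=
  (List.range (numBlocks σ S.length / superLen S.length + 1)).flatMap fun i =>
    field (Nat.size (S.length * Nat.size S.length)) (start σ S (i * superLen S.length))

/-- The starting positions of the blocks, and the end of the last one, relative to the starting
positions of their superblocks, in `O(log log n)` bits each. -/
def blockTable (σ : ℕ) (S : List ℕ) : List Bool :=
  (List.range (numBlocks σ S.length + 1)).flatMap fun i =>
    field (Nat.size (superLen S.length * Nat.size S.length))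
      (start σ S i - start σ S (i / superLen S.length * superLen S.length))

/-- The table that lists the distinct blocks by rank, with `⌈lg σ⌉` bits for each character. -/
def decodeTable (σ : ℕ) (S : List ℕ) : List Bool :=
  (sortedBlocks σ S).flatMap fun B => B.flatMap fun c => field (Nat.clog 2 σ) (c - 1)

/-- Ferragina and Venturini's representation of the string `S` over the alphabet `{1, …, σ}`. -/
def representation (σ : ℕ) (S : List ℕ) : List Bool :=
  superTable σ S ++ blockTable σ S ++ codes σ S ++ decodeTable σ S

end FerraginaVenturini

/-! Let `b` be the block length and cut the range of values `j` into chunks of `b` consecutive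
values. All entries are at least `1`, so every block has sum at least `b`. Hence a chunk meets at
most two blocks, and moving on by one chunk moves on by at most one block (`blockAt_mul_sub_le`).
For each chunk store the block that covers its first value (absolutely for every `superLen n`th
chunk, otherwise relatively), together with the distances from that value back to the start of this
block and on to the start of the next. Two divisions and one comparison then find the block
containing `j` and the offset of `j` in it (`locateCode_spec`).

Two neighbouring entries of the Ferragina–Venturini tables delimit the codeword of this block, and
the codeword determines its rank (`rankCode_spec`). There are at most `√n` distinct blocks, so a
table indexed by rank and offset can list all answers inside blocks. The block itself is never
decoded.

Space: there are about `n * σ / b` chunks with `O(log log n)` bits each, and `b` is at least of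
order `log n / log log n`. The cost is of order `n * σ * (log log n)² / log n`, which is `o(n)`
exactly by the hypothesis on `σ`; the answer table takes only `√n` times a power of `log n` bits
(`extraLen_le_log`).

One program serves all `n` and `w`, so all parameters lie in memory, preceded by a field that
reveals its own width (`widthCode_spec`). The program has no jumps and never overwrites a register
before its last instruction, so its correctness reduces to solving a system of equations
(`computes_of_isSSA`). -/

/-! ## Bit fields in memory -/

namespace WordRAM

/-- The `k` bits of `mem` from address `a` on are the `k` least significant bits of `x`. -/
def HoldsAt (mem : List Bool) (a k x : ℕ) : Prop :=
  ∀ t < k, mem.getD (a + t) false = x.testBit t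

theorem testBit_readWord (w : ℕ) (mem : List Bool) (a t : ℕ) :
    (readWord w mem a).testBit t = (decide (t < w) && mem.getD (a + t) false) := by
  unfold readWord
  by_cases h : t < w
  · rw [Nat.testBit_ofBits_lt _ _ h]; simp [h]
  · rw [Nat.testBit_ofBits_ge _ _ (by omega)]; simp [h]

theorem readWord_lt (w : ℕ) (mem : List Bool) (a : ℕ) : readWord w mem a < 2 ^ w :=
  Nat.ofBits_lt_two_pow _

/-- A load returns `w` bits whatever the field width is; the reduction cuts off what follows the
field. The number `x` may exceed the field: a codeword holds all bits of `rank + 1` except the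
leading one. -/
theorem HoldsAt.readWord_mod {mem : List Bool} {a k x w : ℕ} (h : HoldsAt mem a k x)
    (hk : k ≤ w) : readWord w mem a % 2 ^ k = x % 2 ^ k := by
  refine Nat.eq_of_testBit_eq fun t => ?_
  rw [Nat.testBit_mod_two_pow, Nat.testBit_mod_two_pow, testBit_readWord]
  by_cases ht : t < k
  · simp only [ht, h t ht, show t < w by omega, decide_true, Bool.true_and]
  · simp [ht]

theorem HoldsAt.readWord_mod_of_lt {mem : List Bool} {a k x w : ℕ} (h : HoldsAt mem a k x)
    (hk : k ≤ w) (hx : x < 2 ^ k) : readWord w mem a % 2 ^ k = x := by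
  rw [h.readWord_mod hk, Nat.mod_eq_of_lt hx]

theorem holdsAt_append {A C B : List Bool} {k x : ℕ} (hk : C.length = k)
    (h : ∀ t < k, C.getD t false = x.testBit t) : HoldsAt (A ++ (C ++ B)) A.length k x := by
  intro t ht
  rw [List.getD_append_right _ _ _ _ (by omega), List.getD_append _ _ _ _ (by omega),
    ← h t ht]
  congr 1; omega

end WordRAM

namespace FerraginaVenturini

@[simp] theorem length_field (k x : ℕ) : (field k x).length = k := by simp [field]

theorem getD_field {k t : ℕ} (x : ℕ) (ht : t < k) : (field k x).getD t false = x.testBit t := by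
  rw [List.getD_eq_getElem _ _ (by simpa using ht)]; simp [field]

theorem flatMap_range_split {α : Type*} (f : ℕ → List α) {i m : ℕ} (h : i < m) :
    ∃ B, (List.range m).flatMap f = (List.range i).flatMap f ++ (f i ++ B) := by
  obtain ⟨c, rfl⟩ : ∃ c, m = i + 1 + c := ⟨m - (i + 1), by omega⟩
  refine ⟨((List.range c).map (i + 1 + ·)).flatMap f, ?_⟩
  rw [List.range_add, List.range_succ]
  simp

/-- The array of the numbers `g 0, …, g (m - 1)` in fields of `k` bits. -/
def table (k m : ℕ) (g : ℕ → ℕ) : List Bool :=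
  (List.range m).flatMap fun i => field k (g i)

@[simp] theorem length_table (k m : ℕ) (g : ℕ → ℕ) : (table k m g).length = m * k := by
  simp [table, List.length_flatMap]

theorem holdsAt_table {A B mem : List Bool} {k m a : ℕ} {g : ℕ → ℕ}
    (hmem : mem = A ++ (table k m g ++ B)) (ha : A.length = a) {i : ℕ} (hi : i < m) :
    WordRAM.HoldsAt mem (a + i * k) k (g i) := by
  obtain ⟨C, hC⟩ := flatMap_range_split (fun i => field k (g i)) hi
  have := WordRAM.holdsAt_append (A := A ++ table k i g) (C := field k (g i)) (B := C ++ B)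
    (length_field k (g i)) (fun t ht => getD_field (g i) ht)
  rw [List.length_append, length_table, ha] at this
  rw [hmem, table, hC]
  simpa [table] using this

end FerraginaVenturini

/-! ## Straight-line programs in single-assignment form -/

namespace WordRAM

/-- The register that an instruction writes. -/
def Instr.dest : Instr → ℕ
  | .const d _ => d
  | .op _ d _ _ => d
  | .load d _ => d
  | .jlt _ _ _ => 0

/-- The value that an instruction writes. -/
def Instr.value (w : ℕ) (mem : List Bool) (R : ℕ → ℕ) : Instr → ℕ
  | .const _ c => c % 2 ^ w
  | .op o _ a b => o.eval w (R a) (R b)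
  | .load _ a => readWord w mem (R a)
  | .jlt _ _ _ => 0

/-- The instruction writes register `m` and reads only registers below `m`. -/
def Instr.assigns (m : ℕ) : Instr → Bool
  | .const d _ => d == m
  | .op _ d a b => d == m && decide (a < m) && decide (b < m)
  | .load d a => d == m && decide (a < m)
  | .jlt _ _ _ => false

/-- The instructions write the registers `m, m + 1, …` in turn and read only earlier ones. -/
def isSSA : ℕ → List Instr → Bool
  | _, [] => true
  | m, i :: l => i.assigns m && isSSA (m + 1) l

theorem Instr.exec_of_assigns {w : ℕ} {mem : List Bool} {m : ℕ} {i : Instr} (h : i.assigns m)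
    (s : State) : i.exec w mem s = ⟨s.pc + 1, Function.update s.reg m (i.value w mem s.reg)⟩ := by
  cases i <;> simp_all [assigns, exec, value]

theorem Instr.dest_of_assigns {m : ℕ} {i : Instr} (h : i.assigns m) : i.dest = m := by
  cases i <;> simp_all [assigns, dest]

theorem Instr.value_congr {w : ℕ} {mem : List Bool} {m : ℕ} {i : Instr} (h : i.assigns m)
    {R R' : ℕ → ℕ} (hR : ∀ r < m, R r = R' r) : i.value w mem R = i.value w mem R' := by
  cases i <;> simp_all [assigns, value]

/-- No register is written twice and every operand is final when it is read, so the equation of each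
instruction still holds in the last state. The prefix `pre` makes the induction on the program
counter go through. -/
theorem exists_run_of_isSSA (w : ℕ) (mem : List Bool) (post : List Instr) :
    ∀ (l : List Instr) (m : ℕ) (pre : List Instr) (reg : ℕ → ℕ), isSSA m l →
      ∃ R : ℕ → ℕ, (step w mem (pre ++ l ++ post))^[l.length] ⟨pre.length, reg⟩ =
          ⟨pre.length + l.length, R⟩ ∧
        (∀ r < m, R r = reg r) ∧ ∀ i ∈ l, R i.dest = i.value w mem R
  | [], m, pre, reg, _ => ⟨reg, by simp⟩
  | i :: l, m, pre, reg, h => by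
    rw [isSSA, Bool.and_eq_true] at h
    obtain ⟨R, hrun, hold, hnew⟩ := exists_run_of_isSSA w mem post l (m + 1) (pre ++ [i])
      (Function.update reg m (i.value w mem reg)) h.2
    have hstep : step w mem (pre ++ i :: l ++ post) ⟨pre.length, reg⟩ =
        ⟨(pre ++ [i]).length, Function.update reg m (i.value w mem reg)⟩ := by
      have : (pre ++ i :: l ++ post)[pre.length]? = some i := by simp
      simp only [step, this, Instr.exec_of_assigns h.1, List.length_append, List.length_singleton]
    have hlow : ∀ r < m, R r = reg r := fun r hr => by
      rw [hold r (by omega), Function.update_of_ne (by omega)]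
    refine ⟨R, ?_, hlow, ?_⟩
    · rw [List.length_cons, Function.iterate_succ_apply, hstep]
      have e : pre ++ i :: l ++ post = pre ++ [i] ++ l ++ post := by simp
      rw [e, hrun]
      simp only [List.length_append, List.length_singleton, State.mk.injEq, and_true]
      omega
    · intro i' hi'
      rcases List.mem_cons.1 hi' with rfl | hi'
      · rw [Instr.dest_of_assigns h.1, hold m (by omega), Function.update_self,
          Instr.value_congr h.1 hlow]
      · exact hnew i' hi'

/-- A program in single-assignment form, followed by a copy of the register `out` to register `0`,
computes whatever the equations expressed by its instructions force `out` to be. -/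
theorem computes_of_isSSA {w : ℕ} {mem : List Bool} {l : List Instr} {out x y : ℕ}
    (h : isSSA 1 l)
    (hy : ∀ R : ℕ → ℕ, R 0 = x → (∀ i ∈ l, R i.dest = i.value w mem R) → R out = y) :
    Computes w mem (l ++ [.op .or 0 out out]) x (l.length + 1) y := by
  obtain ⟨R, hrun, hold, hnew⟩ :=
    exists_run_of_isSSA w mem [.op .or 0 out out] l 1 [] (init x).reg h
  have h0 : R 0 = x := by rw [hold 0 (by omega)]; simp [init]
  have hlast : (step w mem (l ++ [.op .or 0 out out]))^[l.length + 1] (init x) =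
      ⟨l.length + 1, Function.update R 0 (R out)⟩ := by
    rw [Function.iterate_succ_apply']
    have e : init x = ⟨([] : List Instr).length, (init x).reg⟩ := rfl
    rw [List.nil_append] at hrun
    rw [e, hrun]
    simp [step, Instr.exec, Op.eval]
  refine ⟨l.length + 1, le_rfl, ?_, ?_⟩
  · rw [hlast]; simp
  · rw [hlast]; simpa using hy R h0 hnew

/-- Read the field with index `R idx` of the array at address `R base` with fields of `R width`
bits, where `R modulus` is two to the power of `R width`. -/
def fetch (d base idx width modulus : ℕ) : List Instr :=
  [.op .mul d idx width, .op .add (d + 1) base d, .load (d + 2) (d + 1),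
    .op .mod (d + 3) (d + 2) modulus]

theorem fetch_spec {w : ℕ} {mem : List Bool} {R : ℕ → ℕ} {d base idx width modulus : ℕ}
    (h : ∀ i ∈ fetch d base idx width modulus, R i.dest = i.value w mem R) {a i k x : ℕ}
    (hbase : R base = a) (hidx : R idx = i) (hwidth : R width = k) (hmod : R modulus = 2 ^ k)
    (hmem : HoldsAt mem (a + i * k) k x) (hk : k ≤ w) (ha : a + i * k < 2 ^ w)
    (hx : x < 2 ^ k) : R (d + 3) = x := by
  simp only [fetch, List.forall_mem_cons, Instr.dest, Instr.value, Op.eval, hbase, hidx, hwidth,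
    hmod] at h
  obtain ⟨h0, h1, h2, h3, -⟩ := h
  rw [Nat.mod_eq_of_lt (by omega)] at h0
  rw [h0, Nat.mod_eq_of_lt ha] at h1
  rw [h3, h2, h1, hmem.readWord_mod_of_lt hk hx]

/-- The lowest set bit of a word. -/
theorem and_neg_eq_two_pow {w p m : ℕ} (h : 2 ^ p * (2 * m + 1) < 2 ^ w) :
    2 ^ p * (2 * m + 1) &&& (2 ^ w - 2 ^ p * (2 * m + 1)) = 2 ^ p := by
  have hpw : p < w := by
    rw [← Nat.pow_lt_pow_iff_right (a := 2) (by norm_num)]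
    nlinarith [Nat.two_pow_pos p]
  obtain ⟨c, rfl⟩ : ∃ c, w = p + (c + 1) := ⟨w - p - 1, by omega⟩
  have hm : m < 2 ^ c := by
    rw [pow_add, pow_succ] at h
    have := Nat.lt_of_mul_lt_mul_left h
    omega
  -- Negation fixes the bit `p` and complements all bits above it: `2 ^ c - (m + 1)` is the
  -- complement of `m` in `c` bits.
  have e : 2 ^ (p + (c + 1)) - 2 ^ p * (2 * m + 1) = 2 ^ p * (2 * (2 ^ c - (m + 1)) + 1) := by
    rw [pow_add, ← Nat.mul_sub]
    congr 1
    rw [pow_succ]; omega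
  rw [e]
  refine Nat.eq_of_testBit_eq fun t => ?_
  rw [Nat.testBit_and, Nat.testBit_two_pow_mul, Nat.testBit_two_pow_mul, Nat.testBit_two_pow]
  rcases lt_trichotomy t p with ht | rfl | ht
  · simp [show ¬ p ≤ t by omega, show p ≠ t by omega]
  · simp
  · obtain ⟨s, rfl⟩ : ∃ s, t = p + (s + 1) := ⟨t - p - 1, by omega⟩
    simp only [Nat.add_sub_cancel_left, Nat.testBit_succ,
      show p ≠ p + (s + 1) by omega, decide_false]
    rw [show (2 * m + 1) / 2 = m by omega,
      show (2 * (2 ^ c - (m + 1)) + 1) / 2 = 2 ^ c - (m + 1) by omega,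
      Nat.testBit_two_pow_sub_succ hm]
    cases m.testBit s <;> simp

end WordRAM

/-! ## Partial sums -/

namespace PartialSums

/-- The sum of the first `i` entries of the infinite sequence `S, 1, 1, 1, …`. -/
def prefixSum (S : List ℕ) (i : ℕ) : ℕ := ∑ t ∈ Finset.range i, S.getD t 1

@[simp] theorem prefixSum_zero (S : List ℕ) : prefixSum S 0 = 0 := rfl

theorem prefixSum_succ (S : List ℕ) (i : ℕ) :
    prefixSum S (i + 1) = prefixSum S i + S.getD i 1 := Finset.sum_range_succ _ _

theorem sum_take_succ_getD (S : List ℕ) {i : ℕ} (hi : i < S.length) :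
    (S.take (i + 1)).sum = (S.take i).sum + S.getD i 1 := by
  rw [List.getD_eq_getElem _ _ hi, List.sum_take_succ S i hi]

theorem sum_take_eq_prefixSum (S : List ℕ) {i : ℕ} (hi : i ≤ S.length) :
    (S.take i).sum = prefixSum S i := by
  induction i with
  | zero => simp
  | succ i ih => rw [sum_take_succ_getD S hi, ih (by omega), prefixSum_succ]

theorem sum_eq_prefixSum (S : List ℕ) : S.sum = prefixSum S S.length := by
  rw [← sum_take_eq_prefixSum S le_rfl, List.take_length]

theorem getD_mem_Icc {S : List ℕ} {m : ℕ} (hm : 1 ≤ m) (hS : ∀ x ∈ S, 1 ≤ x ∧ x ≤ m) (t : ℕ) :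
    1 ≤ S.getD t 1 ∧ S.getD t 1 ≤ m := by
  by_cases ht : t < S.length
  · rw [List.getD_eq_getElem _ _ ht]; exact hS _ (List.getElem_mem ht)
  · rw [List.getD_eq_default _ _ (by omega)]; omega

theorem prefixSum_add_le {S : List ℕ} {m : ℕ} (hm : 1 ≤ m) (hS : ∀ x ∈ S, 1 ≤ x ∧ x ≤ m)
    (i c : ℕ) : prefixSum S (i + c) ≤ prefixSum S i + c * m := by
  induction c with
  | zero => simp
  | succ c ih =>
    rw [← add_assoc, prefixSum_succ, add_mul, one_mul]
    have := (getD_mem_Icc hm hS (i + c)).2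
    omega

theorem le_prefixSum_add {S : List ℕ} (hS : ∀ x ∈ S, 1 ≤ x) (i c : ℕ) :
    prefixSum S i + c ≤ prefixSum S (i + c) := by
  induction c with
  | zero => simp
  | succ c ih =>
    rw [← add_assoc, ← add_assoc, prefixSum_succ]
    have : 1 ≤ S.getD (i + c) 1 := by
      by_cases ht : i + c < S.length
      · rw [List.getD_eq_getElem _ _ ht]; exact hS _ (List.getElem_mem ht)
      · rw [List.getD_eq_default _ _ (by omega)]
    omega

theorem prefixSum_mono (S : List ℕ) : Monotone (prefixSum S) :=
  monotone_nat_of_le_succ fun i => by rw [prefixSum_succ]; omega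

theorem lt_of_prefixSum_lt {S : List ℕ} {i k : ℕ} (h : prefixSum S i < prefixSum S k) : i < k :=
  (prefixSum_mono S).reflect_lt h

theorem search_le_length (S : List ℕ) (j : ℕ) : search S j ≤ S.length := Nat.findGreatest_le _

theorem sum_take_search_le (S : List ℕ) (j : ℕ) : (S.take (search S j)).sum ≤ j := by
  have := Nat.findGreatest_spec (P := fun i => (S.take i).sum ≤ j) (n := S.length)
    (Nat.zero_le _) (by simp)
  exact this

theorem lt_sum_take_search_succ {S : List ℕ} {j : ℕ} (h : j < S.sum) :
    search S j < S.length ∧ j < (S.take (search S j + 1)).sum := by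
  have hlt : search S j < S.length := by
    refine lt_of_le_of_ne (search_le_length S j) fun he => ?_
    have := sum_take_search_le S j
    rw [he, List.take_length] at this
    omega
  exact ⟨hlt, not_le.1 (Nat.findGreatest_is_greatest (P := fun i => (S.take i).sum ≤ j)
    (Nat.lt_succ_self _) hlt)⟩

theorem search_eq_length {S : List ℕ} {j : ℕ} (h : S.sum ≤ j) : search S j = S.length :=
  le_antisymm (search_le_length S j) (Nat.le_findGreatest le_rfl (by simpa using h))

/-- By monotonicity only one interval between consecutive prefix sums contains `j`; `j < S.sum`
keeps it out of the padding. -/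
theorem search_eq_of_prefixSum {S : List ℕ} {i j : ℕ} (hj : j < S.sum)
    (h1 : prefixSum S i ≤ j) (h2 : j < prefixSum S (i + 1)) : search S j = i := by
  obtain ⟨hlt, hs⟩ := lt_sum_take_search_succ hj
  have hs' := sum_take_search_le S j
  rw [sum_take_eq_prefixSum S (by omega)] at hs hs'
  have := lt_of_prefixSum_lt (h1.trans_lt hs)
  have := lt_of_prefixSum_lt (hs'.trans_lt h2)
  omega

/-- The number of the block of `b` entries that covers the value `v`. -/
def blockAt (S : List ℕ) (b v : ℕ) : ℕ :=
  Nat.findGreatest (fun k => prefixSum S (k * b) ≤ v) v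

theorem prefixSum_blockAt_le (S : List ℕ) (b v : ℕ) : prefixSum S (blockAt S b v * b) ≤ v :=
  Nat.findGreatest_spec (P := fun k => prefixSum S (k * b) ≤ v) (Nat.zero_le v) (by simp)

theorem le_prefixSum {S : List ℕ} (hS : ∀ x ∈ S, 1 ≤ x) (c : ℕ) : c ≤ prefixSum S c := by
  simpa using le_prefixSum_add hS 0 c

theorem lt_prefixSum_blockAt {S : List ℕ} (hS : ∀ x ∈ S, 1 ≤ x) {b : ℕ} (hb : 1 ≤ b) (v : ℕ) :
    v < prefixSum S ((blockAt S b v + 1) * b) := by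
  by_contra! h
  have h1 := le_prefixSum hS ((blockAt S b v + 1) * b)
  have h2 := Nat.le_mul_of_pos_right (blockAt S b v + 1) hb
  -- Positive entries give `k ≤ prefixSum S (k * b)`, so the cutoff `v` in the definition of
  -- `blockAt` loses no candidate.
  have := Nat.le_findGreatest (P := fun k => prefixSum S (k * b) ≤ v)
    (h2.trans (h1.trans h)) h
  change blockAt S b v + 1 ≤ blockAt S b v at this
  omega

theorem blockAt_mul_le {S : List ℕ} (hS : ∀ x ∈ S, 1 ≤ x) {b : ℕ} (hb : 1 ≤ b) (i : ℕ) :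
    blockAt S b (b * i) ≤ i := by
  have h1 := le_prefixSum hS (blockAt S b (b * i) * b)
  have h2 := prefixSum_blockAt_le S b (b * i)
  rw [mul_comm b i] at *
  exact Nat.le_of_mul_le_mul_right (h1.trans h2) hb

/-- Block `k₀ + 1` begins after the value `b * i₀`, and each further block adds at least `b`, so `c`
chunks cannot advance by more than `c` blocks. This keeps the relative entries of the chunk table
small. -/
theorem blockAt_mul_sub_le {S : List ℕ} (hS : ∀ x ∈ S, 1 ≤ x) {b : ℕ} (hb : 1 ≤ b) {i₀ i : ℕ}
    (hi : i₀ ≤ i) : blockAt S b (b * i) - blockAt S b (b * i₀) ≤ i - i₀ := by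
  obtain ⟨c, rfl⟩ := Nat.exists_eq_add_of_le hi
  by_contra! h
  set k₀ := blockAt S b (b * i₀)
  set k := blockAt S b (b * (i₀ + c))
  have h1 : b * i₀ < prefixSum S ((k₀ + 1) * b) := lt_prefixSum_blockAt hS hb _
  have h2 : prefixSum S (k * b) ≤ b * (i₀ + c) := prefixSum_blockAt_le S b _
  have h3 := le_prefixSum_add hS ((k₀ + 1) * b) (c * b)
  rw [← add_mul] at h3
  have h4 := prefixSum_mono S (Nat.mul_le_mul_right b (show k₀ + 1 + c ≤ k by omega))
  have h5 : b * (i₀ + c) = b * i₀ + c * b := by ring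
  omega

theorem blockAt_mono (S : List ℕ) (b : ℕ) : Monotone (blockAt S b) := fun _ _ h =>
  Nat.findGreatest_mono (fun _ hk => le_trans hk h) h

end PartialSums

/-! ### Blocks of the sequence and searches inside them -/

namespace FerraginaVenturini

open PartialSums

@[simp] theorem length_block (σ : ℕ) (S : List ℕ) (k : ℕ) :
    (block σ S k).length = blockLen σ S.length := by simp [block]

theorem one_le_blockLen (σ n : ℕ) : 1 ≤ blockLen σ n := le_max_left _ _

/-- The last block and `prefixSum` are padded with the same character `1`, so no bound on `k` is
needed. -/
theorem sum_take_block (σ : ℕ) (S : List ℕ) (k : ℕ) {t : ℕ} (ht : t ≤ blockLen σ S.length) :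
    prefixSum S (k * blockLen σ S.length) + ((block σ S k).take t).sum =
      prefixSum S (k * blockLen σ S.length + t) := by
  induction t with
  | zero => simp
  | succ t ih =>
    rw [sum_take_succ_getD _ (by simpa using ht), ← add_assoc, ih (by omega), ← add_assoc,
      prefixSum_succ, List.getD_eq_getElem _ _ (by simpa using ht)]
    simp [block]

/-- A search inside the block that covers the argument gives the global result. -/
theorem search_eq_block {σ : ℕ} {S : List ℕ} {j k : ℕ} (hj : j < S.sum)
    (h1 : prefixSum S (k * blockLen σ S.length) ≤ j)
    (h2 : j < prefixSum S ((k + 1) * blockLen σ S.length)) :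
    search S j = k * blockLen σ S.length +
      search (block σ S k) (j - prefixSum S (k * blockLen σ S.length)) := by
  set b := blockLen σ S.length with hb
  set x := j - prefixSum S (k * b) with hx
  have hsum := sum_take_block σ S k (le_refl (blockLen σ S.length))
  rw [← hb] at hsum
  have hlen : (block σ S k).take b = block σ S k := by
    rw [hb, ← length_block σ S k, List.take_length]
  rw [hlen, ← Nat.succ_mul] at hsum
  have hxs : x < (block σ S k).sum := by
    have : prefixSum S (k.succ * b) = prefixSum S ((k + 1) * b) := rfl
    omega
  obtain ⟨hlt, hs⟩ := lt_sum_take_search_succ hxs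
  have hs' := sum_take_search_le (block σ S k) x
  rw [length_block, ← hb] at hlt
  have e1 := sum_take_block σ S k (t := search (block σ S k) x) (by omega)
  have e2 := sum_take_block σ S k (t := search (block σ S k) x + 1) (by omega)
  rw [← hb] at e1 e2
  refine search_eq_of_prefixSum hj ?_ ?_
  · omega
  · rw [add_assoc]; omega

theorem mul_blockLen_lt_of_lt_sum {S : List ℕ} {b j k : ℕ} (hj : j < S.sum)
    (h1 : prefixSum S (k * b) ≤ j) : k * b < S.length := by
  rw [sum_eq_prefixSum] at hj
  exact lt_of_prefixSum_lt (h1.trans_lt hj)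

theorem lt_numBlocks {σ n k : ℕ} (h : k * blockLen σ n < n) : k < numBlocks σ n := by
  have hb := one_le_blockLen σ n
  rw [numBlocks, ← Nat.succ_le_iff, Nat.le_div_iff_mul_le hb, Nat.succ_mul]
  omega

theorem numBlocks_le (σ n : ℕ) : numBlocks σ n ≤ n := by
  have hb := one_le_blockLen σ n
  rcases n with _ | n
  · rw [numBlocks, Nat.div_eq_of_lt (by omega)]
  · refine Nat.div_le_of_le_mul ?_
    obtain ⟨c, hc⟩ := Nat.exists_eq_add_of_le hb
    have : (1 + c) * (n + 1) = n + 1 + c * n + c := by ring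
    rw [hc, this]; omega

/-! ## The positions of the codewords -/

theorem length_codeword (r : ℕ) : (codeword r).length = Nat.size (r + 1) - 1 := by
  rw [codeword, List.length_dropLast, Nat.size_eq_bits_len]

theorem getD_codeword {r t : ℕ} (ht : t < (codeword r).length) :
    (codeword r).getD t false = (r + 1).testBit t := by
  have ht' : t < (Nat.bits (r + 1)).length := by
    rw [codeword, List.length_dropLast] at ht; omega
  rw [Nat.testBit_eq_inth, List.getD_eq_getElem _ _ ht, List.getI_eq_getElem _ ht']
  simp [codeword]

/-- The length is `⌊lg (r + 1)⌋`, so `2 ^ length` is precisely the leading `1` that the codeword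
omits. -/
theorem codeword_bounds (r : ℕ) :
    2 ^ (codeword r).length ≤ r + 1 ∧ r + 1 < 2 ^ ((codeword r).length + 1) := by
  have hpos : 0 < Nat.size (r + 1) := Nat.size_pos.2 r.succ_pos
  rw [length_codeword]
  refine ⟨Nat.lt_size.1 (by omega), ?_⟩
  rw [Nat.sub_add_cancel hpos]
  exact Nat.lt_size_self _

/-- The rank of the `i`th block. -/
def rank (σ : ℕ) (S : List ℕ) (i : ℕ) : ℕ := (sortedBlocks σ S).idxOf (block σ S i)

theorem start_succ (σ : ℕ) (S : List ℕ) (i : ℕ) :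
    start σ S (i + 1) = start σ S i + (blockCode σ S i).length := by
  simp [start, List.range_succ]

theorem start_mono (σ : ℕ) (S : List ℕ) : Monotone (start σ S) :=
  monotone_nat_of_le_succ fun i => by rw [start_succ]; omega

theorem holdsAt_codes {σ : ℕ} {A B mem : List Bool} {T : List ℕ} {a k : ℕ}
    (hmem : mem = A ++ (codes σ T ++ B)) (ha : A.length = a) (hk : k < numBlocks σ T.length) :
    WordRAM.HoldsAt mem (a + start σ T k) (blockCode σ T k).length (rank σ T k + 1) := by
  obtain ⟨C, hC⟩ := flatMap_range_split (blockCode σ T) hk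
  have := WordRAM.holdsAt_append (A := A ++ (List.range k).flatMap (blockCode σ T))
    (C := blockCode σ T k) (B := C ++ B) (x := rank σ T k + 1) rfl
    (fun t ht => getD_codeword ht)
  rw [List.length_append, List.length_flatMap, ha] at this
  rw [hmem, codes, hC]
  simpa [start] using this

theorem block_mem_sortedBlocks {σ : ℕ} {S : List ℕ} {k : ℕ} (hk : k < numBlocks σ S.length) :
    block σ S k ∈ sortedBlocks σ S := by
  rw [sortedBlocks, List.mem_mergeSort, List.mem_dedup, blocks]
  exact List.mem_map_of_mem (List.mem_range.2 hk)

theorem rank_lt_length {σ : ℕ} {S : List ℕ} {k : ℕ} (hk : k < numBlocks σ S.length) :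
    rank σ S k < (sortedBlocks σ S).length := List.idxOf_lt_length_of_mem (block_mem_sortedBlocks hk)

theorem sortedBlocks_getD_rank {σ : ℕ} {S : List ℕ} {k : ℕ} (hk : k < numBlocks σ S.length) :
    (sortedBlocks σ S).getD (rank σ S k) [] = block σ S k := by
  rw [List.getD_eq_getElem _ _ (rank_lt_length hk)]
  exact List.getElem_idxOf _

theorem nodup_sortedBlocks (σ : ℕ) (S : List ℕ) : (sortedBlocks σ S).Nodup :=
  (List.mergeSort_perm _ _).nodup_iff.2 (List.nodup_dedup _)

/-- There are at most `σ ^ b` distinct blocks of `b` characters. -/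
theorem length_sortedBlocks_le {σ : ℕ} {S : List ℕ} (hσ : 1 ≤ σ)
    (hS : ∀ x ∈ S, 1 ≤ x ∧ x ≤ σ) :
    (sortedBlocks σ S).length ≤ σ ^ blockLen σ S.length := by
  set b := blockLen σ S.length with hb
  let f : (Fin b → Fin σ) → List ℕ := fun g => List.ofFn fun i => (g i : ℕ) + 1
  have hsub : (sortedBlocks σ S).toFinset ⊆ (Finset.univ : Finset (Fin b → Fin σ)).image f := by
    intro B hB
    rw [List.mem_toFinset, sortedBlocks, List.mem_mergeSort, List.mem_dedup, blocks,
      List.mem_map] at hB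
    obtain ⟨k, -, rfl⟩ := hB
    refine Finset.mem_image.2 ⟨fun i => ⟨S.getD (k * b + i) 1 - 1, ?_⟩, Finset.mem_univ _, ?_⟩
    · have := getD_mem_Icc hσ hS (k * b + i); omega
    · refine List.ext_getElem (by simp [f, hb]) fun t h1 h2 => ?_
      have := getD_mem_Icc hσ hS (k * b + t)
      simp only [f, List.getElem_ofFn, block, List.getElem_map, List.getElem_range, ← hb]
      omega
  have := (Finset.card_le_card hsub).trans Finset.card_image_le
  rwa [List.toFinset_card_of_nodup (nodup_sortedBlocks σ S), Finset.card_univ, Fintype.card_fun,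
    Fintype.card_fin, Fintype.card_fin] at this

/-- The hypothesis makes the logarithm at least `1`, so the `max 1` in `blockLen` is inactive; since
the logarithm has base `max 2 σ ^ 2`, the square of `σ ^ b` is at most `n`. -/
theorem pow_blockLen_le_sqrt {σ n : ℕ} (hn : (max 2 σ) ^ 2 ≤ n) :
    σ ^ blockLen σ n ≤ Nat.sqrt n := by
  have h2 : 4 ≤ max 2 σ ^ 2 := by nlinarith [le_max_left 2 σ]
  have hlog : 1 ≤ Nat.log (max 2 σ ^ 2) n := Nat.log_pos (by omega) hn
  rw [blockLen, max_eq_right hlog, Nat.le_sqrt', ← pow_mul, mul_comm, pow_mul]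
  exact (Nat.pow_le_pow_left (Nat.pow_le_pow_left (le_max_right 2 σ) 2) _).trans
    (Nat.pow_log_le_self _ (by omega))

theorem rank_lt_and_length_blockCode_lt {σ : ℕ} {S : List ℕ} (hσ : 1 ≤ σ) (hS : ∀ x ∈ S, 1 ≤ x ∧ x ≤ σ)
    (hn : (max 2 σ) ^ 2 ≤ S.length) {k : ℕ} (hk : k < numBlocks σ S.length) :
    rank σ S k < Nat.sqrt S.length ∧ (blockCode σ S k).length < Nat.size S.length := by
  have h1 : rank σ S k < Nat.sqrt S.length := (rank_lt_length hk).trans_le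
    ((length_sortedBlocks_le hσ hS).trans (pow_blockLen_le_sqrt hn))
  refine ⟨h1, Nat.lt_size.2 ((codeword_bounds _).1.trans ?_)⟩
  exact (Nat.succ_le_of_lt h1).trans (Nat.sqrt_le_self _)

theorem start_sub_le {σ : ℕ} {S : List ℕ} (hσ : 1 ≤ σ) (hS : ∀ x ∈ S, 1 ≤ x ∧ x ≤ σ)
    (hn : (max 2 σ) ^ 2 ≤ S.length) {k c : ℕ} (hk : k + c ≤ numBlocks σ S.length) :
    start σ S (k + c) ≤ start σ S k + c * Nat.size S.length := by
  induction c with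
  | zero => simp
  | succ c ih =>
    have := (rank_lt_and_length_blockCode_lt hσ hS hn (show k + c < _ by omega)).2
    have := ih (by omega)
    rw [← add_assoc, start_succ, add_mul, one_mul]
    omega

theorem start_le {σ : ℕ} {S : List ℕ} (hσ : 1 ≤ σ) (hS : ∀ x ∈ S, 1 ≤ x ∧ x ≤ σ)
    (hn : (max 2 σ) ^ 2 ≤ S.length) {k : ℕ} (hk : k ≤ numBlocks σ S.length) :
    start σ S k ≤ S.length * Nat.size S.length := by
  have := start_sub_le hσ hS hn (k := 0) (c := k) (by omega)
  rw [zero_add, show start σ S 0 = 0 from rfl, zero_add] at this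
  exact this.trans (Nat.mul_le_mul_right _ (hk.trans (numBlocks_le σ _)))

end FerraginaVenturini

/-! ## The query program -/

namespace WordRAM

theorem sub_eval {w x y : ℕ} (hy : y ≤ x) (hx : x < 2 ^ w) : (x + (2 ^ w - y)) % 2 ^ w = x - y := by
  rw [show x + (2 ^ w - y) = x - y + 2 ^ w by omega, Nat.add_mod_right, Nat.mod_eq_of_lt (by omega)]

theorem one_shl_eval {w y : ℕ} (hy : y < w) : (1 <<< y) % 2 ^ w = 2 ^ y := by
  rw [Nat.one_shiftLeft, Nat.mod_eq_of_lt (Nat.pow_lt_pow_right (by norm_num) hy)]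

/-- `1 / (1 + x / y)` decides in registers whether `x < y`. -/
theorem one_div_one_add_div {w x y : ℕ} (hw : 1 < 2 ^ w) (hx : x < 2 ^ w) (hy : 0 < y) :
    1 / ((1 + x / y) % 2 ^ w) = if x < y then 1 else 0 := by
  split_ifs with h
  · rw [Nat.div_eq_of_lt h, add_zero, Nat.mod_eq_of_lt hw, Nat.div_one]
  · have h1 : 1 ≤ x / y := (Nat.one_le_div_iff hy).2 (by omega)
    have h2 : x / y ≤ x := Nat.div_le_self _ _
    rcases lt_or_eq_of_le (show 1 + x / y ≤ 2 ^ w by omega) with h3 | h3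
    · rw [Nat.mod_eq_of_lt h3, Nat.div_eq_of_lt (by omega)]
    · rw [h3, Nat.mod_self, Nat.div_zero]

end WordRAM

namespace SearchIndex

open WordRAM PartialSums FerraginaVenturini

/-- Read the width of an address field, which is an odd number `h`, from the first field
`h * 2 ^ p`, and its power `2 ^ h`. -/
def widthCode : List Instr :=
  [.const 1 0, .load 2 1, .op .sub 3 1 2, .op .and 4 2 3, .op .div 5 2 4, .op .mod 6 5 4,
    .const 7 1, .op .shl 8 7 6]

/-- Read the parameters `1, …, 17`; the parameter `c` goes to register `8 + 5 * c`. -/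
def paramCode : List Instr :=
  (List.range 17).flatMap fun c => .const (9 + 5 * c) (c + 1) :: fetch (10 + 5 * c) 1 (9 + 5 * c) 6 8

/-- Find the block that contains the argument (register `121`) and the position of the argument
relative to it (register `126`). Register `96` tells whether the argument is below the total sum. -/
def locateCode : List Instr :=
  [.op .div 94 0 13, .op .add 95 7 94, .op .div 96 7 95,
    .op .div 97 0 23, .op .mod 98 0 23, .op .div 99 97 28] ++
  fetch 100 43 99 6 8 ++ fetch 104 48 97 33 38 ++ [.op .add 108 103 107] ++
  fetch 109 53 97 33 38 ++ fetch 113 58 97 33 38 ++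
  [.op .div 117 98 112, .op .add 118 7 117, .op .div 119 7 118, .op .sub 120 7 119,
    .op .add 121 108 120, .op .add 122 98 116, .op .mul 123 122 119, .op .sub 124 98 112,
    .op .mul 125 124 120, .op .add 126 123 125]

/-- Compute the rank of the block in register `121` from its codeword (to register `154`). -/
def rankCode : List Instr :=
  [.op .div 127 121 28] ++ fetch 128 73 127 78 83 ++ fetch 132 88 121 33 38 ++
  [.op .add 136 131 135, .op .add 137 121 7, .op .div 138 137 28] ++
  fetch 139 73 138 78 83 ++ fetch 143 88 137 33 38 ++
  [.op .add 147 142 146, .op .sub 148 147 136, .op .shl 149 7 148, .op .add 150 93 136,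
    .load 151 150, .op .mod 152 151 149, .op .add 153 152 149, .op .sub 154 153 7]

/-- Look up the answer within the block and combine. -/
def answerCode : List Instr :=
  [.op .mul 155 154 68, .op .add 156 155 126] ++ fetch 157 63 156 33 38 ++
  [.op .mul 161 121 23, .op .add 162 161 160, .op .mul 163 162 96, .op .sub 164 7 96,
    .op .mul 165 18 164, .op .add 166 163 165]

/-- The query program without the final move. -/
def queryCode : List Instr := widthCode ++ paramCode ++ locateCode ++ rankCode ++ answerCode

/-- The query program. -/
def query : Program := queryCode ++ [.op .or 0 166 166]

/-! ### Correctness of the parts of the query program -/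

theorem isSSA_queryCode : isSSA 1 queryCode = true := by decide +kernel

/-- `R` satisfies the equations expressed by the instructions. -/
def Solves (w : ℕ) (mem : List Bool) (R : ℕ → ℕ) (l : List Instr) : Prop :=
  ∀ i ∈ l, R i.dest = i.value w mem R

theorem solves_append {w : ℕ} {mem : List Bool} {R : ℕ → ℕ} {l l' : List Instr} :
    Solves w mem R (l ++ l') ↔ Solves w mem R l ∧ Solves w mem R l' := List.forall_mem_append

theorem solves_cons {w : ℕ} {mem : List Bool} {R : ℕ → ℕ} {i : Instr} {l : List Instr} :
    Solves w mem R (i :: l) ↔ R i.dest = i.value w mem R ∧ Solves w mem R l := List.forall_mem_cons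

variable {w : ℕ} {mem : List Bool} {R : ℕ → ℕ}

/-- The field must be legible before its width is known. Since `h` is odd, the lowest set bit of the
word is `2 ^ p` whatever follows the field; since `h < 2 ^ p`, the next `p` bits are `h`; and `2 * p
≤ h` puts all foreign bits above both. -/
theorem widthCode_spec (hR : Solves w mem R widthCode) {h p : ℕ} (hh : h % 2 = 1)
    (hp : h < 2 ^ p) (hph : 2 * p ≤ h) (hw : h < w) (hmem : HoldsAt mem 0 h (h * 2 ^ p)) :
    R 1 = 0 ∧ R 6 = h ∧ R 7 = 1 ∧ R 8 = 2 ^ h := by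
  simp only [widthCode, solves_cons, Instr.dest, Instr.value, Op.eval] at hR
  obtain ⟨h1, h2, h3, h4, h5, h6, h7, h8, -⟩ := hR
  have hw1 : 1 < 2 ^ w := Nat.one_lt_two_pow (by omega)
  rw [Nat.zero_mod] at h1
  rw [Nat.mod_eq_of_lt hw1] at h7
  set x := readWord w mem 0 with hx
  have hxw : x < 2 ^ w := readWord_lt _ _ _
  have hlt : h * 2 ^ p < 2 ^ (2 * p) := by
    rw [two_mul, pow_add]; exact Nat.mul_lt_mul_of_pos_right hp (by positivity)
  have hlt' : h * 2 ^ p < 2 ^ h := hlt.trans_le (Nat.pow_le_pow_right (by norm_num) hph)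
  have hmod : x % 2 ^ h = h * 2 ^ p := hmem.readWord_mod_of_lt hw.le hlt'
  obtain ⟨c, rfl⟩ : ∃ c, h = 2 * p + c := ⟨h - 2 * p, by omega⟩
  obtain ⟨y, hy⟩ : ∃ y, x = 2 ^ p * (2 ^ p * y + (2 * p + c)) := by
    refine ⟨2 ^ c * (x / 2 ^ (2 * p + c)), ?_⟩
    conv_lhs => rw [← Nat.div_add_mod x (2 ^ (2 * p + c)), hmod]
    rw [pow_add, two_mul, pow_add]; ring
  have hp0 : p ≠ 0 := by rintro rfl; omega
  obtain ⟨p', rfl⟩ := Nat.exists_eq_succ_of_ne_zero hp0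
  -- As `p` is positive, the foreign bits contribute an even number, and the quotient by `2 ^ p`
  -- inherits the oddness of `h`.
  obtain ⟨m, hm⟩ : ∃ m, 2 ^ p'.succ * y + (2 * p'.succ + c) = 2 * m + 1 :=
    ⟨2 ^ p' * y + (2 * p'.succ + c) / 2, by rw [pow_succ]; grind⟩
  have hxm : x = 2 ^ p'.succ * (2 * m + 1) := by rw [← hm, ← hy]
  rw [h1] at h2
  have h3' : R 3 = 2 ^ w - x := by
    have : 0 < x := by rw [hxm]; positivity
    rw [h3, h1, h2, zero_add, Nat.mod_eq_of_lt (by omega)]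
  rw [h3', h2, ← hx, hxm, and_neg_eq_two_pow (hxm ▸ hxw)] at h4
  rw [h2, h4, ← hx, hy, Nat.mul_div_cancel_left _ (by positivity)] at h5
  rw [h5, h4, Nat.mul_add_mod, Nat.mod_eq_of_lt hp] at h6
  rw [h7, h6, one_shl_eval hw] at h8
  exact ⟨h1, h6, h7, h8⟩

theorem paramCode_spec (hR : Solves w mem R paramCode) {h : ℕ} {π : ℕ → ℕ} (hw : h < w)
    (h1 : R 1 = 0) (h6 : R 6 = h) (h8 : R 8 = 2 ^ h)
    (hmem : ∀ c < 18, HoldsAt mem (c * h) h (π c)) (hlen : 18 * h < 2 ^ w) (hw18 : 18 ≤ 2 ^ w)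
    (hπ : ∀ c < 18, π c < 2 ^ h) {c : ℕ} (hc : c < 17) : R (8 + 5 * (c + 1)) = π (c + 1) := by
  have hc' : Solves w mem R
      (.const (9 + 5 * c) (c + 1) :: fetch (10 + 5 * c) 1 (9 + 5 * c) 6 8) := fun i hi =>
    hR i (List.mem_flatMap.2 ⟨c, List.mem_range.2 hc, hi⟩)
  rw [solves_cons] at hc'
  obtain ⟨hidx, hf⟩ := hc'
  simp only [Instr.dest, Instr.value] at hidx
  rw [Nat.mod_eq_of_lt (by omega)] at hidx
  have hlt : (c + 1) * h < 2 ^ w := lt_of_le_of_lt (Nat.mul_le_mul_right h (by omega)) hlen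
  have := fetch_spec hf h1 hidx h6 h8 (x := π (c + 1))
    (by simpa using hmem (c + 1) (by omega)) hw.le (by simpa using hlt) (hπ _ (by omega))
  rw [← this]; congr 1; omega

theorem locateCode_spec (hR : Solves w mem R locateCode) {S : List ℕ} {σ j b l v h a₀ a₁ a₂ a₃ : ℕ}
    (h0 : R 0 = j) (h6 : R 6 = h) (h7 : R 7 = 1) (h8 : R 8 = 2 ^ h) (h13 : R 13 = S.sum)
    (h23 : R 23 = b) (h28 : R 28 = l) (h33 : R 33 = v) (h38 : R 38 = 2 ^ v)
    (h43 : R 43 = a₀) (h48 : R 48 = a₁) (h53 : R 53 = a₂) (h58 : R 58 = a₃)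
    (hσ : 1 ≤ σ) (hS : ∀ x ∈ S, 1 ≤ x ∧ x ≤ σ) (hb : 1 ≤ b) (hl : 1 ≤ l) (hlv : l < 2 ^ v)
    (hbv : b * σ < 2 ^ v) (hvw : v < w) (hhw : h < w) (hN : S.sum < 2 ^ h) (hj : j < S.sum)
    (m₀ : HoldsAt mem (a₀ + j / b / l * h) h (blockAt S b (b * (j / b / l * l))))
    (m₁ : HoldsAt mem (a₁ + j / b * v) v
      (blockAt S b (b * (j / b)) - blockAt S b (b * (j / b / l * l))))
    (m₂ : HoldsAt mem (a₂ + j / b * v) v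
      (prefixSum S ((blockAt S b (b * (j / b)) + 1) * b) - b * (j / b)))
    (m₃ : HoldsAt mem (a₃ + j / b * v) v
      (b * (j / b) - prefixSum S (blockAt S b (b * (j / b)) * b)))
    (l₀ : a₀ + j / b / l * h < 2 ^ w) (l₁ : a₁ + j / b * v < 2 ^ w)
    (l₂ : a₂ + j / b * v < 2 ^ w) (l₃ : a₃ + j / b * v < 2 ^ w) :
    R 96 = 1 ∧ prefixSum S (R 121 * b) ≤ j ∧ j < prefixSum S ((R 121 + 1) * b) ∧
      R 126 = j - prefixSum S (R 121 * b) := by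
  have hS1 : ∀ x ∈ S, 1 ≤ x := fun x hx => (hS x hx).1
  simp only [locateCode, solves_append, solves_cons, Instr.dest, Instr.value, Op.eval] at hR
  obtain ⟨⟨⟨⟨⟨⟨⟨h94, h95, h96, h97, h98, h99, -⟩, f103⟩, f107⟩, h108, -⟩, f112⟩, f116⟩,
    h117, h118, h119, h120, h121, h122, h123, h124, h125, h126, -⟩ := hR
  have hw1 : 1 < 2 ^ w := Nat.one_lt_two_pow (by omega)
  have hhw' : 2 ^ h < 2 ^ w := Nat.pow_lt_pow_right (by norm_num) hhw
  have hvw' : 2 * 2 ^ v ≤ 2 ^ w := by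
    rw [← pow_succ']; exact Nat.pow_le_pow_right (by norm_num) hvw
  have hjw : j < 2 ^ w := by omega
  rw [h0, h13] at h94
  rw [h7, h94] at h95
  rw [h7, h95, one_div_one_add_div hw1 hjw (by omega), if_pos hj] at h96
  rw [h0, h23] at h97 h98
  rw [h97, h28] at h99
  set i := j / b with hi
  set i₀ := i / l * l with hi₀
  set k := blockAt S b (b * i) with hk
  have hi₀i : i₀ ≤ i := Nat.div_mul_le_self _ _
  have hij : i ≤ j := Nat.div_le_self _ _
  have hk₀ : blockAt S b (b * i₀) ≤ i₀ := blockAt_mul_le hS1 hb _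
  have hkk : blockAt S b (b * i₀) ≤ k := blockAt_mono S b (Nat.mul_le_mul_left b hi₀i)
  have hki : k ≤ i := blockAt_mul_le hS1 hb _
  have hsub := blockAt_mul_sub_le hS1 hb hi₀i
  have hlmod : i - i₀ < l := by
    have := Nat.div_add_mod i l
    have := Nat.mod_lt i hl
    rw [mul_comm] at *
    omega
  have hkle : prefixSum S (k * b) ≤ b * i := prefixSum_blockAt_le S b _
  have hklt : b * i < prefixSum S ((k + 1) * b) := lt_prefixSum_blockAt hS1 hb _
  have hstep : prefixSum S ((k + 1) * b) ≤ prefixSum S (k * b) + b * σ := by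
    rw [add_mul, one_mul]; exact prefixSum_add_le hσ hS _ _
  -- Block `k + 1` spans at least `b` values and starts after `b * i`, so it extends past the end of
  -- the chunk: `j` lies in block `k` or `k + 1`.
  have hstep' := le_prefixSum_add hS1 ((k + 1) * b) b
  rw [show (k + 1) * b + b = (k + 1 + 1) * b by ring] at hstep'
  have hjdiv : b * i + j % b = j := Nat.div_add_mod j b
  have hjmod : j % b < b := Nat.mod_lt _ hb
  have hbσ : b ≤ b * σ := Nat.le_mul_of_pos_right _ hσ
  have r103 := fetch_spec f103 h43 h99 h6 h8 m₀ hhw.le l₀ (by omega)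
  have r107 := fetch_spec f107 h48 h97 h33 h38 m₁ hvw.le l₁ (by omega)
  have r112 := fetch_spec f112 h53 h97 h33 h38 m₂ hvw.le l₂ (by omega)
  have r116 := fetch_spec f116 h58 h97 h33 h38 m₃ hvw.le l₃ (by omega)
  rw [r103, r107, Nat.add_sub_cancel' hkk, Nat.mod_eq_of_lt (by omega)] at h108
  rw [h98, r112] at h117 h124
  rw [h7, h117] at h118
  rw [h7, h118, one_div_one_add_div hw1 (by omega) (by omega)] at h119
  rw [h98, r116, Nat.mod_eq_of_lt (by omega)] at h122
  refine ⟨h96, ?_⟩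
  -- Register `119` is `1` if `j` lies in block `k` and `0` if it lies in block `k + 1`; register
  -- `120` is its complement. Both candidate offsets are computed and one is multiplied by zero, so
  -- the subtraction that wraps around in the first case does no harm.
  by_cases hd : j % b < prefixSum S ((k + 1) * b) - b * i
  · rw [if_pos hd] at h119
    rw [h7, h119, sub_eval le_rfl hw1, Nat.sub_self] at h120
    rw [h108, h120, add_zero, Nat.mod_eq_of_lt (by omega)] at h121
    rw [h122, h119, mul_one, Nat.mod_eq_of_lt (by omega)] at h123
    rw [h120, mul_zero, Nat.zero_mod] at h125
    rw [h123, h125, add_zero, Nat.mod_eq_of_lt (by omega)] at h126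
    rw [h121, h126]
    omega
  · have hk1j : k + 1 ≤ j := (Nat.le_mul_of_pos_right _ hb).trans
      ((le_prefixSum hS1 ((k + 1) * b)).trans (by omega))
    rw [if_neg hd] at h119
    rw [h7, h119, sub_eval (Nat.zero_le _) hw1] at h120
    rw [h108, h120, Nat.sub_zero, Nat.mod_eq_of_lt (by omega)] at h121
    rw [h122, h119, mul_zero, Nat.zero_mod] at h123
    rw [sub_eval (by omega) (by omega)] at h124
    rw [h124, h120, Nat.sub_zero, mul_one, Nat.mod_eq_of_lt (by omega)] at h125
    rw [h123, h125, zero_add, Nat.mod_eq_of_lt (by omega)] at h126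
    rw [h121, h126]
    omega

/-- Codewords are not prefix-free, so the length comes from the starting positions of blocks `k` and
`k + 1`; the tables include the end of the last block for this purpose. Adding `2 ^ length` to the
bits read restores the leading `1` of `rank + 1`. -/
theorem rankCode_spec (hR : Solves w mem R rankCode) {S : List ℕ} {σ k u v f₀ f₁ f₂ : ℕ}
    (h7 : R 7 = 1) (h28 : R 28 = superLen S.length) (h33 : R 33 = v) (h38 : R 38 = 2 ^ v)
    (h73 : R 73 = f₀) (h78 : R 78 = u) (h83 : R 83 = 2 ^ u) (h88 : R 88 = f₁) (h93 : R 93 = f₂)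
    (h121 : R 121 = k) (hσ : 1 ≤ σ) (hS : ∀ x ∈ S, 1 ≤ x ∧ x ≤ σ)
    (hn : max 2 σ ^ 2 ≤ S.length) (hk : k < numBlocks σ S.length)
    (hu : S.length * Nat.size S.length < 2 ^ u)
    (hv : superLen S.length * Nat.size S.length < 2 ^ v) (hvw : v < w) (huw : u < w)
    (m₀ : ∀ i ≤ numBlocks σ S.length / superLen S.length,
      HoldsAt mem (f₀ + i * u) u (start σ S (i * superLen S.length)))
    (m₁ : ∀ i ≤ numBlocks σ S.length, HoldsAt mem (f₁ + i * v) v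
      (start σ S i - start σ S (i / superLen S.length * superLen S.length)))
    (m₂ : HoldsAt mem (f₂ + start σ S k) (blockCode σ S k).length (rank σ S k + 1))
    (l₀ : f₀ + numBlocks σ S.length / superLen S.length * u < 2 ^ w)
    (l₁ : f₁ + numBlocks σ S.length * v < 2 ^ w)
    (l₂ : f₂ + S.length * Nat.size S.length < 2 ^ w) : R 154 = rank σ S k := by
  simp only [rankCode, solves_append, solves_cons, Instr.dest, Instr.value, Op.eval] at hR
  obtain ⟨⟨⟨⟨⟨⟨⟨h127, -⟩, f131⟩, f135⟩, h136, h137, h138, -⟩, f142⟩, f146⟩,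
    h147, h148, h149, h150, h151, h152, h153, h154, -⟩ := hR
  set l := superLen S.length with hl
  set nb := numBlocks σ S.length with hnb
  have hnpos : 0 < S.length := lt_of_lt_of_le (by positivity) hn
  have hlpos : 0 < l := Nat.size_pos.2 hnpos
  have hnb' : nb ≤ S.length := numBlocks_le _ _
  have hnw : S.length < 2 ^ w := by
    have := Nat.le_mul_of_pos_right S.length hlpos
    have h : S.length * l = S.length * Nat.size S.length := rfl
    omega
  have key : ∀ i ≤ nb, start σ S (i / l * l) < 2 ^ u ∧
      start σ S i - start σ S (i / l * l) < 2 ^ v ∧ i / l ≤ nb / l ∧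
      start σ S (i / l * l) ≤ start σ S i ∧ start σ S i ≤ S.length * Nat.size S.length := by
    intro i hi
    have hil : i / l * l ≤ i := Nat.div_mul_le_self _ _
    have h1 := start_le hσ hS hn (hil.trans hi)
    have h2 := start_sub_le hσ hS hn (k := i / l * l) (c := i % l)
      (by rw [mul_comm, Nat.div_add_mod]; exact hi)
    rw [mul_comm, Nat.div_add_mod, mul_comm] at h2
    have h3 : i % l * Nat.size S.length ≤ l * Nat.size S.length :=
      Nat.mul_le_mul_right _ (Nat.mod_lt _ hlpos).le
    exact ⟨by omega, by omega, Nat.div_le_div_right hi, start_mono σ S hil,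
      start_le hσ hS hn hi⟩
  have starts : ∀ {i d d' e : ℕ}, i ≤ nb → R d = i → R e = i / l →
      Solves w mem R (fetch d' 73 e 78 83) → Solves w mem R (fetch (d' + 4) 88 d 33 38) →
      (R (d' + 3) + R (d' + 4 + 3)) % 2 ^ w = start σ S i := by
    intro i d d' e hi hd he hf hf'
    obtain ⟨k1, k2, k3, k4, k5⟩ := key i hi
    have e1 := fetch_spec hf h73 he h78 h83 (m₀ _ k3) huw.le
      (lt_of_le_of_lt (Nat.add_le_add_left (Nat.mul_le_mul_right _ k3) _) l₀) k1
    have e2 := fetch_spec hf' h88 hd h33 h38 (m₁ i hi) hvw.le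
      (lt_of_le_of_lt (Nat.add_le_add_left (Nat.mul_le_mul_right _ hi) _) l₁) k2
    rw [e1, e2, Nat.add_sub_cancel' k4, Nat.mod_eq_of_lt (by omega)]
  rw [h121, h28] at h127
  rw [starts hk.le h121 h127 f131 f135] at h136
  rw [h121, h7, Nat.mod_eq_of_lt (by omega)] at h137
  rw [h137, h28] at h138
  rw [starts (i := k + 1) (d := 137) (d' := 139) hk h137 h138 f142 f146] at h147
  have hs := start_succ σ S k
  have hs1 := (key (k + 1) hk).2.2.2.2
  rw [h147, h136, sub_eval (by omega) (by omega), hs, Nat.add_sub_cancel_left] at h148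
  obtain ⟨c1, c2⟩ := codeword_bounds (rank σ S k)
  obtain ⟨hrank, hcode⟩ := rank_lt_and_length_blockCode_lt hσ hS hn hk
  change 2 ^ (blockCode σ S k).length ≤ _ at c1
  change _ < 2 ^ ((blockCode σ S k).length + 1) at c2
  have hrn := hrank.trans_le (Nat.sqrt_le_self _)
  have hcw : (blockCode σ S k).length < w := by
    rw [← Nat.pow_lt_pow_iff_right (a := 2) (by norm_num)]; omega
  rw [h7, h148, one_shl_eval hcw] at h149
  rw [h93, h136, Nat.mod_eq_of_lt (by omega)] at h150
  rw [h150] at h151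
  rw [h151, h149, m₂.readWord_mod hcw.le] at h152
  have hmod : (rank σ S k + 1) % 2 ^ (blockCode σ S k).length + 2 ^ (blockCode σ S k).length
      = rank σ S k + 1 := by
    rw [pow_succ] at c2
    rw [Nat.mod_eq_sub_mod c1, Nat.mod_eq_of_lt (by omega)]; omega
  rw [h152, h149, hmod, Nat.mod_eq_of_lt (by omega)] at h153
  rw [h153, h7, sub_eval (by omega) (by omega)] at h154
  exact h154

theorem answerCode_spec_of_lt (hR : Solves w mem R answerCode) {r x q v k b a y : ℕ}
    (h7 : R 7 = 1) (h23 : R 23 = b) (h33 : R 33 = v) (h38 : R 38 = 2 ^ v) (h63 : R 63 = a)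
    (h68 : R 68 = q) (h96 : R 96 = 1) (h121 : R 121 = k) (h126 : R 126 = x) (h154 : R 154 = r)
    (hrx : r * q + x < 2 ^ w) (hvw : v < w) (hyv : y < 2 ^ v)
    (hmem : HoldsAt mem (a + (r * q + x) * v) v y)
    (haw : a + (r * q + x) * v < 2 ^ w) (hky : k * b + y < 2 ^ w) : R 166 = k * b + y := by
  simp only [answerCode, solves_append, solves_cons, Instr.dest, Instr.value, Op.eval] at hR
  obtain ⟨⟨⟨h155, h156, -⟩, f160⟩, h161, h162, h163, h164, h165, h166, -⟩ := hR
  have hw1 : 1 < 2 ^ w := Nat.one_lt_two_pow (by omega)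
  rw [h154, h68, Nat.mod_eq_of_lt (by omega)] at h155
  rw [h155, h126, Nat.mod_eq_of_lt hrx] at h156
  have r160 := fetch_spec f160 h63 h156 h33 h38 hmem hvw.le haw hyv
  rw [h121, h23, Nat.mod_eq_of_lt (by omega)] at h161
  rw [h161, r160, Nat.mod_eq_of_lt hky] at h162
  rw [h162, h96, mul_one, Nat.mod_eq_of_lt hky] at h163
  rw [h7, h96, sub_eval le_rfl hw1, Nat.sub_self] at h164
  rw [h164, mul_zero, Nat.zero_mod] at h165
  rw [h166, h163, h165, add_zero, Nat.mod_eq_of_lt hky]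

/-- For arguments beyond the total sum the lookups may return garbage, but the flag in register `96`
is zero, cancels it and selects `n` instead. -/
theorem queryCode_spec_of_le (hL : Solves w mem R locateCode) (hA : Solves w mem R answerCode)
    {j s n : ℕ} (hw : 1 < 2 ^ w) (hj : j < 2 ^ w) (hs : 0 < s) (hsj : s ≤ j) (hn : n < 2 ^ w)
    (h0 : R 0 = j) (h7 : R 7 = 1) (h13 : R 13 = s) (h18 : R 18 = n) : R 166 = n := by
  simp only [locateCode, answerCode, solves_append, solves_cons, Instr.dest, Instr.value, Op.eval]
    at hL hA
  obtain ⟨⟨⟨⟨⟨⟨⟨h94, h95, h96, -⟩, -⟩, -⟩, -⟩, -⟩, -⟩, -⟩ := hL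
  obtain ⟨-, -, -, h163, h164, h165, h166, -⟩ := hA
  rw [h0, h13] at h94
  rw [h7, h94] at h95
  rw [h7, h95, one_div_one_add_div hw hj hs, if_neg (by omega)] at h96
  rw [h96, mul_zero, Nat.zero_mod] at h163
  rw [h7, h96, sub_eval (Nat.zero_le _) hw] at h164
  rw [h18, h164, Nat.sub_zero, mul_one, Nat.mod_eq_of_lt hn] at h165
  rw [h166, h163, h165, zero_add, Nat.mod_eq_of_lt hn]

end SearchIndex

/-! ## The additional data -/

namespace SearchIndex

open WordRAM PartialSums FerraginaVenturini

/-- The width of address fields; an odd number slightly below `2 * lg n`. -/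
def addrBits (n : ℕ) : ℕ := 2 * Nat.log 2 n - 1

/-- The width of the small fields, `O(log log n)`. -/
def fieldBits (n : ℕ) : ℕ := Nat.size (superLen n * superLen n)

/-- The width of the fields in the table of the starting positions of superblocks. -/
def startBits (n : ℕ) : ℕ := Nat.size (n * Nat.size n)

/-- The number of chunks of length `blockLen σ n` that the range of arguments is cut into. -/
def numChunks (σ n : ℕ) : ℕ := n * σ / blockLen σ n + 1

/-- The address of the table of blocks at the starts of superchunks. -/
def superAddr (n : ℕ) : ℕ := 18 * addrBits n

/-- The address of the table of blocks at the starts of chunks, relative to superchunks. -/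
def relAddr (σ n : ℕ) : ℕ := superAddr n + (numChunks σ n / superLen n + 1) * addrBits n

/-- The address of the table of the distances from the starts of chunks to the next blocks. -/
def nextAddr (σ n : ℕ) : ℕ := relAddr σ n + numChunks σ n * fieldBits n

/-- The address of the table of the distances from the starts of blocks to those of chunks. -/
def prevAddr (σ n : ℕ) : ℕ := nextAddr σ n + numChunks σ n * fieldBits n

/-- The address of the table of the answers within blocks. -/
def localAddr (σ n : ℕ) : ℕ := prevAddr σ n + numChunks σ n * fieldBits n

/-- The number of the additional bits. -/
def extraLen (σ n : ℕ) : ℕ :=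
  localAddr σ n + Nat.sqrt n * (superLen n * superLen n) * fieldBits n

/-- The address of the table of the starting positions of blocks. -/
def blockAddr (σ n : ℕ) : ℕ :=
  extraLen σ n + (numBlocks σ n / superLen n + 1) * startBits n

/-- The address of the codewords. -/
def codesAddr (σ n : ℕ) : ℕ := blockAddr σ n + (numBlocks σ n + 1) * fieldBits n

/-- The parameters that the query program reads. -/
def params (σ n s : ℕ) : List ℕ :=
  [addrBits n * 2 ^ Nat.size (addrBits n), s, n, blockLen σ n, superLen n, fieldBits n,
    2 ^ fieldBits n, superAddr n, relAddr σ n, nextAddr σ n, prevAddr σ n, localAddr σ n,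
    superLen n * superLen n, extraLen σ n, startBits n, 2 ^ startBits n, blockAddr σ n,
    codesAddr σ n]

/-- The block at the start of the `i`th chunk. -/
def chunkBlock (σ : ℕ) (S : List ℕ) (i : ℕ) : ℕ :=
  blockAt S (blockLen σ S.length) (blockLen σ S.length * i)

/-- The answers within the blocks, in the order of the ranks of the blocks. -/
def localAnswer (σ : ℕ) (S : List ℕ) (x : ℕ) : ℕ :=
  search ((sortedBlocks σ S).getD (x / (superLen S.length * superLen S.length)) [])
    (x % (superLen S.length * superLen S.length))

/-- The additional data. -/
def extra (σ : ℕ) (S : List ℕ) : List Bool :=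
  table (addrBits S.length) 18 (fun c => (params σ S.length S.sum).getD c 0) ++
  (table (addrBits S.length) (numChunks σ S.length / superLen S.length + 1)
    (fun i => chunkBlock σ S (i * superLen S.length)) ++
  (table (fieldBits S.length) (numChunks σ S.length)
    (fun i => chunkBlock σ S i - chunkBlock σ S (i / superLen S.length * superLen S.length)) ++
  (table (fieldBits S.length) (numChunks σ S.length)
    (fun i => prefixSum S ((chunkBlock σ S i + 1) * blockLen σ S.length) -
      blockLen σ S.length * i) ++
  (table (fieldBits S.length) (numChunks σ S.length)
    (fun i => blockLen σ S.length * i -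
      prefixSum S (chunkBlock σ S i * blockLen σ S.length)) ++
  table (fieldBits S.length)
    (Nat.sqrt S.length * (superLen S.length * superLen S.length)) (localAnswer σ S)))))

theorem length_extra (σ : ℕ) (S : List ℕ) : (extra σ S).length = extraLen σ S.length := by
  simp only [extra, List.length_append, length_table, extraLen, localAddr, prevAddr, nextAddr,
    relAddr, superAddr]
  ring

theorem superTable_eq (σ : ℕ) (S : List ℕ) : superTable σ S =
    table (startBits S.length) (numBlocks σ S.length / superLen S.length + 1)
      (fun i => start σ S (i * superLen S.length)) := rfl

/-- By definition `superLen n` is `Nat.size n`, so this table has the same field width as the small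
additional fields and one parameter serves both. -/
theorem blockTable_eq (σ : ℕ) (S : List ℕ) : blockTable σ S =
    table (fieldBits S.length) (numBlocks σ S.length + 1)
      (fun i => start σ S i - start σ S (i / superLen S.length * superLen S.length)) := rfl

/-- The memory that the query program works on. -/
def memory (σ : ℕ) (S : List ℕ) : List Bool := extra σ S ++ representation σ S

/-- From address `a` on, the contents of `mem` are `L`. -/
def EndsWith (mem : List Bool) (a : ℕ) (L : List Bool) : Prop :=
  ∃ A : List Bool, A.length = a ∧ mem = A ++ L

theorem EndsWith.next {mem C D : List Bool} {a c : ℕ} (h : EndsWith mem a (C ++ D))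
    (hc : C.length = c) : EndsWith mem (a + c) D := by
  obtain ⟨A, rfl, rfl⟩ := h
  exact ⟨A ++ C, by simp [hc], by simp⟩

theorem EndsWith.holdsAt {mem D : List Bool} {a k m : ℕ} {g : ℕ → ℕ}
    (h : EndsWith mem a (table k m g ++ D)) {i : ℕ} (hi : i < m) :
    HoldsAt mem (a + i * k) k (g i) := by
  obtain ⟨A, hA, hmem⟩ := h
  exact holdsAt_table hmem hA hi

/-- Where the query program finds its data. -/
theorem memory_layout (σ : ℕ) (S : List ℕ) :
    (∀ c < 18, HoldsAt (memory σ S) (c * addrBits S.length) (addrBits S.length)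
      ((params σ S.length S.sum).getD c 0)) ∧
    (∀ i ≤ numChunks σ S.length / superLen S.length,
      HoldsAt (memory σ S) (superAddr S.length + i * addrBits S.length) (addrBits S.length)
        (chunkBlock σ S (i * superLen S.length))) ∧
    (∀ i < numChunks σ S.length,
      HoldsAt (memory σ S) (relAddr σ S.length + i * fieldBits S.length) (fieldBits S.length)
        (chunkBlock σ S i - chunkBlock σ S (i / superLen S.length * superLen S.length)) ∧
      HoldsAt (memory σ S) (nextAddr σ S.length + i * fieldBits S.length) (fieldBits S.length)
        (prefixSum S ((chunkBlock σ S i + 1) * blockLen σ S.length) -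
          blockLen σ S.length * i) ∧
      HoldsAt (memory σ S) (prevAddr σ S.length + i * fieldBits S.length) (fieldBits S.length)
        (blockLen σ S.length * i - prefixSum S (chunkBlock σ S i * blockLen σ S.length))) ∧
    (∀ i < Nat.sqrt S.length * (superLen S.length * superLen S.length),
      HoldsAt (memory σ S) (localAddr σ S.length + i * fieldBits S.length) (fieldBits S.length)
        (localAnswer σ S i)) ∧
    (∀ i ≤ numBlocks σ S.length / superLen S.length,
      HoldsAt (memory σ S) (extraLen σ S.length + i * startBits S.length) (startBits S.length)
        (start σ S (i * superLen S.length))) ∧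
    (∀ i ≤ numBlocks σ S.length,
      HoldsAt (memory σ S) (blockAddr σ S.length + i * fieldBits S.length) (fieldBits S.length)
        (start σ S i - start σ S (i / superLen S.length * superLen S.length))) ∧
    ∀ k < numBlocks σ S.length, HoldsAt (memory σ S) (codesAddr σ S.length + start σ S k)
      (blockCode σ S k).length (rank σ S k + 1) := by
  have t₀ : EndsWith (memory σ S) 0 (memory σ S) := ⟨[], rfl, rfl⟩
  conv at t₀ =>
    arg 3
    simp only [memory, extra, representation, superTable_eq, blockTable_eq, List.append_assoc]
  -- Each `next` passes over one table; the accumulated sums of lengths are the address definitions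
  -- up to unfolding.
  have t₁ := t₀.next (length_table _ _ _)
  have t₂ := t₁.next (length_table _ _ _)
  have t₃ := t₂.next (length_table _ _ _)
  have t₄ := t₃.next (length_table _ _ _)
  have t₅ := t₄.next (length_table _ _ _)
  have t₆ := t₅.next (length_table _ _ _)
  have t₇ := t₆.next (length_table _ _ _)
  obtain ⟨A, hA, hmem⟩ := t₇.next (length_table _ _ _)
  rw [zero_add] at t₁ t₂ t₃ t₄ t₅ t₆ t₇ hA
  refine ⟨fun c hc => ?_, fun i hi => t₁.holdsAt (Nat.lt_succ_of_le hi),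
    fun i hi => ⟨t₂.holdsAt hi, t₃.holdsAt hi, t₄.holdsAt hi⟩, fun i hi => t₅.holdsAt hi,
    fun i hi => t₆.holdsAt (Nat.lt_succ_of_le hi), fun i hi => t₇.holdsAt (Nat.lt_succ_of_le hi),
    fun k hk => holdsAt_codes hmem hA hk⟩
  simpa only [zero_add] using t₀.holdsAt hc

/-- The numerical conditions under which the data structure works; they hold for large `n`. -/
structure Admissible (σ n : ℕ) : Prop where
  one_le : 1 ≤ σ
  le_superLen : σ ≤ superLen n
  sq_le : max 2 σ ^ 2 ≤ n
  size_addrBits : 2 * Nat.size (addrBits n) ≤ addrBits n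
  codesAddr_lt : codesAddr σ n + 2 * (n * superLen n) < 2 ^ addrBits n

theorem blockLen_le_superLen {σ n : ℕ} (hn : 1 ≤ n) : blockLen σ n ≤ superLen n := by
  refine max_le (Nat.size_pos.2 hn) ((Nat.log_anti_left (b := max 2 σ ^ 2) (c := 2)
    (by norm_num) ?_).trans ?_)
  · have := le_max_left 2 σ; nlinarith
  · exact (Nat.lt_size.2 (Nat.pow_log_le_self 2 (by omega))).le

theorem two_pow_size_le {x : ℕ} (hx : 0 < x) : 2 ^ Nat.size x ≤ 2 * x := by
  have h := Nat.size_pos.2 hx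
  have : 2 ^ (Nat.size x - 1) ≤ x := Nat.lt_size.1 (by omega)
  calc 2 ^ Nat.size x = 2 * 2 ^ (Nat.size x - 1) := by
        rw [← pow_succ', Nat.sub_add_cancel h]
    _ ≤ 2 * x := by omega

theorem Admissible.four_le {σ n : ℕ} (h : Admissible σ n) : 4 ≤ n :=
  le_trans (by nlinarith [le_max_left 2 σ]) h.sq_le

/-- The inequalities between the parameters of the data structure. -/
theorem Admissible.bounds {σ n : ℕ} (h : Admissible σ n) :
    1 ≤ superLen n ∧ blockLen σ n ≤ superLen n ∧ superLen n ≤ n ∧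
      superLen n * superLen n < 2 ^ fieldBits n ∧ n * superLen n < 2 ^ startBits n ∧
      2 ^ fieldBits n < 2 ^ addrBits n ∧ 2 ^ startBits n < 2 ^ addrBits n ∧
      superLen n * superLen n ≤ n * superLen n ∧ n ≤ n * superLen n ∧
      n * σ ≤ n * superLen n := by
  have hn4 := h.four_le
  have hl1 : 1 ≤ superLen n := Nat.size_pos.2 (by omega)
  have hln : superLen n ≤ n := Nat.size_le.2 Nat.lt_two_pow_self
  have hll : superLen n * superLen n ≤ n * superLen n := Nat.mul_le_mul_right _ hln
  have hv2 : 2 ^ fieldBits n ≤ 2 * (superLen n * superLen n) := two_pow_size_le (by positivity)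
  have hu2 : 2 ^ startBits n ≤ 2 * (n * superLen n) := two_pow_size_le (by positivity)
  -- The slack `2 * (n * superLen n)` in this condition dominates both powers of two, since `2 ^
  -- Nat.size x ≤ 2 * x`.
  have hfit := h.codesAddr_lt
  exact ⟨hl1, blockLen_le_superLen (by omega), hln, Nat.lt_size_self _, Nat.lt_size_self _,
    by omega, by omega, hll, Nat.le_mul_of_pos_right _ hl1, Nat.mul_le_mul_left _ h.le_superLen⟩

theorem addrs_le (σ n : ℕ) : superAddr n ≤ relAddr σ n ∧ relAddr σ n ≤ nextAddr σ n ∧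
    nextAddr σ n ≤ prevAddr σ n ∧ prevAddr σ n ≤ localAddr σ n ∧ localAddr σ n ≤ extraLen σ n ∧
    extraLen σ n ≤ blockAddr σ n ∧ blockAddr σ n ≤ codesAddr σ n :=
  ⟨Nat.le_add_right _ _, Nat.le_add_right _ _, Nat.le_add_right _ _, Nat.le_add_right _ _,
    Nat.le_add_right _ _, Nat.le_add_right _ _, Nat.le_add_right _ _⟩

theorem Admissible.params_lt {σ n s : ℕ} (h : Admissible σ n) (hs : s ≤ n * σ) {c : ℕ}
    (hc : c < 18) : (params σ n s).getD c 0 < 2 ^ addrBits n := by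
  have hp : addrBits n * 2 ^ Nat.size (addrBits n) < 2 ^ addrBits n := by
    refine lt_of_lt_of_le (Nat.mul_lt_mul_of_pos_right (Nat.lt_size_self _) (by positivity)) ?_
    rw [← pow_add, ← two_mul]
    exact Nat.pow_le_pow_right (by norm_num) h.size_addrBits
  obtain ⟨h1, h2, h3, h4, h5, h6, h7, h8, h9, h10⟩ := h.bounds
  obtain ⟨a1, a2, a3, a4, a5, a6, a7⟩ := addrs_le σ n
  have hfit := h.codesAddr_lt
  have hv : fieldBits n < 2 ^ fieldBits n := Nat.lt_two_pow_self
  have hu : startBits n < 2 ^ startBits n := Nat.lt_two_pow_self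
  generalize 2 ^ addrBits n = X at *
  have hall : ∀ x ∈ params σ n s, x < X := by
    simp only [params, List.forall_mem_cons]
    refine ⟨hp, ?_, ?_, ?_, ?_, ?_, h6, ?_, ?_, ?_, ?_, ?_, ?_, ?_, ?_, h7, ?_, ?_, by simp⟩ <;>
      omega
  have hc' : c < (params σ n s).length := hc
  rw [List.getD_eq_getElem _ _ hc']
  exact hall _ (List.getElem_mem hc')

/-- The registers that hold the parameters. -/
theorem params_spec {w σ n s : ℕ} {mem : List Bool} {R : ℕ → ℕ} (h : Admissible σ n)
    (hs : s ≤ n * σ) (hw : addrBits n < w)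
    (hmem : ∀ c < 18, HoldsAt mem (c * addrBits n) (addrBits n) ((params σ n s).getD c 0))
    (hW : Solves w mem R widthCode) (hP : Solves w mem R paramCode) :
    R 6 = addrBits n ∧ R 7 = 1 ∧ R 8 = 2 ^ addrBits n ∧
      ∀ c < 17, R (8 + 5 * (c + 1)) = (params σ n s).getD (c + 1) 0 := by
  have hn4 := h.four_le
  have hlog : 2 ≤ Nat.log 2 n := Nat.le_log_of_pow_le (by norm_num) (by omega)
  have hodd : addrBits n % 2 = 1 := by rw [addrBits]; omega
  have hw' : 2 ^ addrBits n < 2 ^ w := Nat.pow_lt_pow_right (by norm_num) hw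
  have hfit := h.codesAddr_lt
  have haddr := addrs_le σ n
  have e₀ : superAddr n = 18 * addrBits n := rfl
  obtain ⟨h1, h6, h7, h8⟩ := widthCode_spec hW hodd (Nat.lt_size_self _) h.size_addrBits hw
    (by have := hmem 0 (by norm_num); rwa [zero_mul] at this)
  refine ⟨h6, h7, h8, fun c hc => paramCode_spec hP hw h1 h6 h8 hmem ?_ ?_
    (fun c hc => h.params_lt hs hc) hc⟩
  · omega
  · have : 3 ≤ addrBits n := by rw [addrBits]; omega
    omega

theorem params_getD (σ n s : ℕ) :
    (params σ n s).getD (0 + 1) 0 = s ∧ (params σ n s).getD (1 + 1) 0 = n ∧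
    (params σ n s).getD (2 + 1) 0 = blockLen σ n ∧ (params σ n s).getD (3 + 1) 0 = superLen n ∧
    (params σ n s).getD (4 + 1) 0 = fieldBits n ∧
    (params σ n s).getD (5 + 1) 0 = 2 ^ fieldBits n ∧
    (params σ n s).getD (6 + 1) 0 = superAddr n ∧ (params σ n s).getD (7 + 1) 0 = relAddr σ n ∧
    (params σ n s).getD (8 + 1) 0 = nextAddr σ n ∧ (params σ n s).getD (9 + 1) 0 = prevAddr σ n ∧
    (params σ n s).getD (10 + 1) 0 = localAddr σ n ∧
    (params σ n s).getD (11 + 1) 0 = superLen n * superLen n ∧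
    (params σ n s).getD (12 + 1) 0 = extraLen σ n ∧
    (params σ n s).getD (13 + 1) 0 = startBits n ∧
    (params σ n s).getD (14 + 1) 0 = 2 ^ startBits n ∧
    (params σ n s).getD (15 + 1) 0 = blockAddr σ n ∧
    (params σ n s).getD (16 + 1) 0 = codesAddr σ n :=
  ⟨rfl, rfl, rfl, rfl, rfl, rfl, rfl, rfl, rfl, rfl, rfl, rfl, rfl, rfl, rfl, rfl, rfl⟩

/-- The `- 1` in `addrBits` makes the inequality strict even for `w = 2 * ⌊lg n⌋`, as forming `2 ^
addrBits n` in a register requires; it also makes the width odd. -/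
theorem addrBits_lt {n w : ℕ} (hn : 2 ≤ n) (hw : n ^ 2 ≤ 2 ^ w) : addrBits n < w := by
  have hlog : 1 ≤ Nat.log 2 n := Nat.le_log_of_pow_le (by norm_num) (by omega)
  rw [← Nat.pow_lt_pow_iff_right (a := 2) (by norm_num)]
  refine lt_of_lt_of_le (b := (2 ^ Nat.log 2 n) ^ 2) ?_
    ((Nat.pow_le_pow_left (Nat.pow_log_le_self 2 (by omega)) 2).trans hw)
  rw [← pow_mul, addrBits]
  exact Nat.pow_lt_pow_right (by norm_num) (by omega)

theorem localAnswer_rank {σ : ℕ} {S : List ℕ} {k x : ℕ} (hk : k < numBlocks σ S.length)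
    (hx : x < superLen S.length * superLen S.length) :
    localAnswer σ S (rank σ S k * (superLen S.length * superLen S.length) + x) =
      search (block σ S k) x := by
  rw [localAnswer, Nat.mul_comm (rank σ S k), Nat.mul_add_div (by omega), Nat.div_eq_of_lt hx,
    add_zero, Nat.mul_add_mod, Nat.mod_eq_of_lt hx, sortedBlocks_getD_rank hk]

theorem query_solution {σ : ℕ} {S : List ℕ} {w j : ℕ} {R : ℕ → ℕ} (h : Admissible σ S.length)
    (hS : ∀ x ∈ S, 1 ≤ x ∧ x ≤ σ) (hw : addrBits S.length < w) (hj : j < 2 ^ w) (h0 : R 0 = j)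
    (hW : Solves w (memory σ S) R widthCode) (hP : Solves w (memory σ S) R paramCode)
    (hL : Solves w (memory σ S) R locateCode) (hK : Solves w (memory σ S) R rankCode)
    (hA : Solves w (memory σ S) R answerCode) : R 166 = search S j := by
  have hS1 : ∀ x ∈ S, 1 ≤ x := fun x hx => (hS x hx).1
  obtain ⟨m₀, m₁, m₂, m₃, m₄, m₅, m₆⟩ := memory_layout σ S
  have hsum : S.sum ≤ S.length * σ := by
    rw [sum_eq_prefixSum]
    simpa using prefixSum_add_le h.one_le hS 0 S.length
  have hsumn : S.length ≤ S.sum := by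
    rw [sum_eq_prefixSum]; exact le_prefixSum hS1 _
  obtain ⟨h6, h7, h8, par⟩ := params_spec h hsum hw m₀ hW hP
  obtain ⟨p0, p1, p2, p3, p4, p5, p6, p7, p8, p9, p10, p11, p12, p13, p14, p15, p16⟩ :=
    params_getD σ S.length S.sum
  have h13 := (par 0 (by norm_num)).trans p0
  have h18 := (par 1 (by norm_num)).trans p1
  have h23 := (par 2 (by norm_num)).trans p2
  have h28 := (par 3 (by norm_num)).trans p3
  have h33 := (par 4 (by norm_num)).trans p4
  have h38 := (par 5 (by norm_num)).trans p5
  have h43 := (par 6 (by norm_num)).trans p6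
  have h48 := (par 7 (by norm_num)).trans p7
  have h53 := (par 8 (by norm_num)).trans p8
  have h58 := (par 9 (by norm_num)).trans p9
  have h63 := (par 10 (by norm_num)).trans p10
  have h68 := (par 11 (by norm_num)).trans p11
  have h73 := (par 12 (by norm_num)).trans p12
  have h78 := (par 13 (by norm_num)).trans p13
  have h83 := (par 14 (by norm_num)).trans p14
  have h88 := (par 15 (by norm_num)).trans p15
  have h93 := (par 16 (by norm_num)).trans p16
  clear p0 p1 p2 p3 p4 p5 p6 p7 p8 p9 p10 p11 p12 p13 p14 p15 p16 par hW hP m₀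
  obtain ⟨b1, b2, b3, b4, b5, b6, b7, b8, b9, b10⟩ := h.bounds
  obtain ⟨a1, a2, a3, a4, a5, a6, a7⟩ := addrs_le σ S.length
  have hn4 := h.four_le
  have hww : 2 ^ addrBits S.length < 2 ^ w := Nat.pow_lt_pow_right (by norm_num) hw
  have hfit := h.codesAddr_lt
  have hfw : codesAddr σ S.length + 2 * (S.length * superLen S.length) < 2 ^ w := hfit.trans hww
  have hvw : fieldBits S.length < w :=
    ((Nat.pow_lt_pow_iff_right (by norm_num)).1 b6).trans hw
  have huw : startBits S.length < w :=
    ((Nat.pow_lt_pow_iff_right (by norm_num)).1 b7).trans hw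
  rcases le_or_gt S.sum j with hsj | hjs
  · rw [search_eq_length hsj]
    exact queryCode_spec_of_le hL hA (by omega) hj (by omega) hsj (by omega) h0 h7 h13 h18
  have hchunk : j / blockLen σ S.length < numChunks σ S.length :=
    Nat.lt_succ_of_le (Nat.div_le_div_right (by omega))
  have hchunk' : j / blockLen σ S.length / superLen S.length ≤
      numChunks σ S.length / superLen S.length := Nat.div_le_div_right hchunk.le
  have hbσ : blockLen σ S.length * σ ≤ superLen S.length * superLen S.length :=
    Nat.mul_le_mul b2 h.le_superLen
  have hlll : superLen S.length ≤ superLen S.length * superLen S.length :=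
    Nat.le_mul_of_pos_right _ b1
  have hcv := Nat.mul_le_mul_right (fieldBits S.length) hchunk.le
  have hch := Nat.mul_le_mul_right (addrBits S.length) (Nat.le_succ_of_le hchunk')
  have e₁ : relAddr σ S.length = superAddr S.length +
    (numChunks σ S.length / superLen S.length).succ * addrBits S.length := rfl
  have e₂ : nextAddr σ S.length =
    relAddr σ S.length + numChunks σ S.length * fieldBits S.length := rfl
  have e₃ : prevAddr σ S.length =
    nextAddr σ S.length + numChunks σ S.length * fieldBits S.length := rfl
  have e₄ : localAddr σ S.length =
    prevAddr σ S.length + numChunks σ S.length * fieldBits S.length := rfl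
  obtain ⟨mr, mn, mp⟩ := m₂ _ hchunk
  obtain ⟨h96, hlo, hhi, h126⟩ := locateCode_spec hL h0 h6 h7 h8 h13 h23 h28 h33 h38 h43 h48 h53
    h58 h.one_le hS (one_le_blockLen _ _) b1 (by omega) (by omega) hvw hw (by omega) hjs
    (m₁ _ hchunk') mr mn mp (by omega) (by omega) (by omega) (by omega)
  clear e₁ e₂ e₃ e₄ hcv hch mr mn mp m₁ m₂
  obtain ⟨k, hk⟩ : ∃ k, R 121 = k := ⟨_, rfl⟩
  rw [hk] at hlo hhi h126
  have hkn : k < numBlocks σ S.length := lt_numBlocks (mul_blockLen_lt_of_lt_sum hjs hlo)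
  have e₆ : blockAddr σ S.length = extraLen σ S.length +
    (numBlocks σ S.length / superLen S.length).succ * startBits S.length := rfl
  have e₇ : codesAddr σ S.length =
    blockAddr σ S.length + (numBlocks σ S.length).succ * fieldBits S.length := rfl
  rw [Nat.succ_mul] at e₆ e₇
  have h154 := rankCode_spec hK h7 h28 h33 h38 h73 h78 h83 h88 h93 hk h.one_le hS h.sq_le hkn b5 b4
    hvw huw m₄ m₅ (m₆ k hkn) (by omega) (by omega)
    (lt_of_le_of_lt (Nat.add_le_add_left (Nat.le_mul_of_pos_left _ two_pos) _) hfw)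
  clear e₆ e₇ m₄ m₅ m₆
  have hrank := (rank_lt_and_length_blockCode_lt h.one_le hS h.sq_le hkn).1
  have hans := search_eq_block hjs hlo hhi
  -- A block has sum at most `b * σ`, and both factors are at most `superLen`; this is the row
  -- length of the answer table.
  have hrem : j - prefixSum S (k * blockLen σ S.length) <
      superLen S.length * superLen S.length := by
    have := prefixSum_add_le h.one_le hS (k * blockLen σ S.length) (blockLen σ S.length)
    rw [← Nat.succ_mul] at this
    change prefixSum S ((k + 1) * blockLen σ S.length) ≤ _ at this
    omega
  generalize j - prefixSum S (k * blockLen σ S.length) = x at *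
  have hidx : rank σ S k * (superLen S.length * superLen S.length) + x <
      Nat.sqrt S.length * (superLen S.length * superLen S.length) := by
    have := Nat.mul_le_mul_right (superLen S.length * superLen S.length) (Nat.succ_le_of_lt hrank)
    rw [Nat.succ_mul] at this
    omega
  have hy : search (block σ S k) x ≤ blockLen σ S.length := by
    simpa using search_le_length (block σ S k) x
  have hres := search_le_length S j
  have hloc := m₃ _ hidx
  rw [localAnswer_rank hkn hrem] at hloc
  have e₅ : extraLen σ S.length = localAddr σ S.length +
    Nat.sqrt S.length * (superLen S.length * superLen S.length) * fieldBits S.length := rfl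
  have hvs := Nat.mul_le_mul_right (fieldBits S.length) hidx.le
  have hv0 : 0 < fieldBits S.length := Nat.size_pos.2 (Nat.mul_pos b1 b1)
  have hvs' := Nat.le_mul_of_pos_right
    (rank σ S k * (superLen S.length * superLen S.length) + x) hv0
  rw [hans]
  exact answerCode_spec_of_lt hA h7 h23 h33 h38 h63 h68 h96 hk h126 h154 (by omega) hvw
    (by omega) hloc (by omega) (by omega)

theorem computes_query {σ : ℕ} {S : List ℕ} {w j : ℕ} (h : Admissible σ S.length)
    (hS : ∀ x ∈ S, 1 ≤ x ∧ x ≤ σ) (hw : S.length ^ 2 ≤ 2 ^ w) (hj : j < 2 ^ w) :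
    Computes w (memory σ S) query j (queryCode.length + 1) (search S j) := by
  refine computes_of_isSSA isSSA_queryCode fun R h0 hR => ?_
  change Solves w (memory σ S) R queryCode at hR
  simp only [queryCode, solves_append] at hR
  obtain ⟨⟨⟨⟨hW, hP⟩, hL⟩, hK⟩, hA⟩ := hR
  have hn4 := h.four_le
  exact query_solution h hS (addrBits_lt (by omega) hw) hj h0 hW hP hL hK hA

end SearchIndex

/-! ## The number of additional bits -/

namespace SearchIndex

open FerraginaVenturini

theorem log_lt_superLen {n : ℕ} (hn : 1 ≤ n) : Real.log n < superLen n := by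
  have h1 : (n : ℝ) < 2 ^ superLen n := by exact_mod_cast Nat.lt_size_self n
  have h2 := Real.log_lt_log (by exact_mod_cast hn) h1
  rw [Real.log_pow] at h2
  have hpos : (0 : ℝ) < superLen n := by exact_mod_cast Nat.size_pos.2 hn
  nlinarith [Real.log_two_lt_d9]

theorem superLen_le_log {n : ℕ} (hn : 1 ≤ Real.log n) : (superLen n : ℝ) ≤ 3 * Real.log n := by
  have hn0 : 0 < n := by
    rcases Nat.eq_zero_or_pos n with rfl | h
    · norm_num at hn
    · exact h
  have h1 : ((2 : ℝ) ^ superLen n) ≤ 2 * n := by exact_mod_cast two_pow_size_le hn0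
  have h2 := Real.log_le_log (by positivity) h1
  rw [Real.log_pow, Real.log_mul (by norm_num) (by positivity)] at h2
  have hpos : (0 : ℝ) ≤ superLen n := Nat.cast_nonneg _
  nlinarith [Real.log_two_lt_d9, Real.log_two_gt_d9]

/-- With `x = log n`, the bound `18 ≤ x` absorbs the constant in `2 * (3 * x) ^ 2 ≤ x ^ 3`; then `3
/ log 2 < 5`. -/
theorem fieldBits_le_log {n : ℕ} (hn : 18 ≤ Real.log n) :
    (fieldBits n : ℝ) ≤ 5 * Real.log (Real.log n) := by
  have hL := superLen_le_log (n := n) (by linarith)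
  have hn0 : 0 < n := by
    rcases Nat.eq_zero_or_pos n with rfl | h
    · norm_num at hn
    · exact h
  have hLpos : 0 < superLen n := Nat.size_pos.2 hn0
  have h1 : ((2 : ℝ) ^ fieldBits n) ≤ 2 * (superLen n * superLen n) := by
    exact_mod_cast two_pow_size_le (Nat.mul_pos hLpos hLpos)
  have h2 : ((2 : ℝ) ^ fieldBits n) ≤ Real.log n ^ 3 := by
    refine h1.trans ?_
    have : (superLen n : ℝ) * superLen n ≤ (3 * Real.log n) * (3 * Real.log n) := by gcongr
    nlinarith [sq_nonneg (Real.log n)]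
  have h3 := Real.log_le_log (by positivity) h2
  rw [Real.log_pow, Real.log_pow] at h3
  have hpos : (0 : ℝ) ≤ fieldBits n := Nat.cast_nonneg _
  push_cast at h3
  nlinarith [Real.log_two_gt_d9]

/-- Blocks have `Ω(log n / log log n)` characters if the alphabet has at most `log n` characters. -/
theorem log_le_blockLen {σ n : ℕ} (hn : 2 ≤ Real.log n) (hσ : σ ≤ Real.log n) :
    Real.log n ≤ 4 * blockLen σ n * Real.log (Real.log n) := by
  have hb : (1 : ℝ) ≤ blockLen σ n := by exact_mod_cast one_le_blockLen σ n
  have hn0 : 0 < n := by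
    rcases Nat.eq_zero_or_pos n with rfl | h
    · norm_num at hn
    · exact h
  have hm : ((max 2 σ : ℕ) : ℝ) ≤ Real.log n := by
    rw [Nat.cast_max]; exact max_le (by exact_mod_cast hn) hσ
  have hm2 : 1 < max 2 σ ^ 2 := by nlinarith [le_max_left 2 σ]
  have h1 : n ≤ (max 2 σ ^ 2) ^ (blockLen σ n + 1) :=
    (Nat.lt_pow_succ_log_self hm2 n).le.trans
      (Nat.pow_le_pow_right (by omega) (Nat.succ_le_succ (le_max_right _ _)))
  have h2 : (n : ℝ) ≤ (Real.log n ^ 2) ^ (blockLen σ n + 1) := by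
    refine (Nat.cast_le.2 h1).trans ?_
    push_cast
    push_cast at hm
    gcongr
  have h3 := Real.log_le_log (by exact_mod_cast hn0) h2
  rw [Real.log_pow, Real.log_pow] at h3
  push_cast at h3
  have hll : 0 ≤ Real.log (Real.log n) := Real.log_nonneg (by linarith)
  -- So far `log n ≤ 2 * (b + 1) * log log n`, and `b + 1 ≤ 2 * b`.
  nlinarith

theorem addrBits_le (n : ℕ) : addrBits n ≤ 2 * superLen n := by
  rcases Nat.eq_zero_or_pos n with rfl | h
  · simp [addrBits]
  · have : Nat.log 2 n < superLen n := Nat.lt_size.2 (Nat.pow_log_le_self 2 (by omega))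
    rw [addrBits]; omega

/-- The superchunk table has one address of at most `2 * superLen n` bits per `superLen n` chunks,
hence at most two bits per chunk plus one more entry. So `38` is `18 * 2 + 2`, and `5` is the three
small tables plus these two bits. -/
theorem extraLen_le {σ n : ℕ} (hn : 1 ≤ n) :
    extraLen σ n ≤ 38 * superLen n + 5 * (numChunks σ n * fieldBits n) +
      Nat.sqrt n * (superLen n * superLen n) * fieldBits n := by
  have hl : 1 ≤ superLen n := Nat.size_pos.2 hn
  have hv : 1 ≤ fieldBits n := Nat.size_pos.2 (Nat.mul_pos hl hl)
  have h1 := addrBits_le n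
  have h2 : numChunks σ n / superLen n * addrBits n ≤ 2 * numChunks σ n :=
    calc numChunks σ n / superLen n * addrBits n
        ≤ numChunks σ n / superLen n * (2 * superLen n) := Nat.mul_le_mul_left _ h1
      _ = 2 * (numChunks σ n / superLen n * superLen n) := by ring
      _ ≤ 2 * numChunks σ n := Nat.mul_le_mul_left _ (Nat.div_mul_le_self _ _)
  have h3 : numChunks σ n ≤ numChunks σ n * fieldBits n := Nat.le_mul_of_pos_right _ hv
  simp only [extraLen, localAddr, prevAddr, nextAddr, relAddr, superAddr, add_mul, one_mul]
  omega

theorem extraLen_le_log {σ n : ℕ} (hn : 18 ≤ Real.log n) (hσ : σ ≤ Real.log n) :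
    (extraLen σ n : ℝ) ≤ 100 * (n * (σ / (Real.log n / Real.log (Real.log n) ^ 2))) +
      184 * (Real.sqrt n * Real.log n ^ 3) := by
  have hn0 : 0 < n := by
    rcases Nat.eq_zero_or_pos n with rfl | h
    · norm_num at hn
    · exact h
  have hL := superLen_le_log (n := n) (by linarith)
  have hV := fieldBits_le_log hn
  have hb := log_le_blockLen (σ := σ) (n := n) (by linarith) hσ
  have hb1 : (1 : ℝ) ≤ blockLen σ n := by exact_mod_cast one_le_blockLen σ n
  have hsqrt : (Nat.sqrt n : ℝ) ≤ Real.sqrt n := Real.nat_sqrt_le_real_sqrt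
  have hs1 : 1 ≤ Real.sqrt n := by
    rw [Real.one_le_sqrt]; exact_mod_cast hn0
  have hle : (extraLen σ n : ℝ) ≤ 38 * superLen n + 5 * (numChunks σ n * fieldBits n) +
      Nat.sqrt n * (superLen n * superLen n) * fieldBits n := by
    exact_mod_cast extraLen_le (σ := σ) hn0
  set x := Real.log n with hx
  set y := Real.log x with hy
  have hy0 : 0 < y := Real.log_pos (by linarith)
  have hyx : y ≤ x := (Real.log_le_sub_one_of_pos (by linarith)).trans (by linarith)
  have hM : (numChunks σ n : ℝ) ≤ 4 * (n * σ * y / x) + 1 := by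
    have h1 : ((n * σ / blockLen σ n : ℕ) : ℝ) ≤ (n * σ : ℝ) / blockLen σ n := by
      exact_mod_cast Nat.cast_div_le (α := ℝ) (m := n * σ) (n := blockLen σ n)
    have h2 : (n * σ : ℝ) / blockLen σ n ≤ 4 * (n * σ * y / x) := by
      rw [← mul_div_assoc, div_le_div_iff₀ (by linarith) (by linarith)]
      calc (n * σ : ℝ) * x ≤ (n * σ : ℝ) * (4 * blockLen σ n * y) := by gcongr
        _ = _ := by ring
    rw [numChunks]; push_cast; linarith
  have hMV : (numChunks σ n : ℝ) * fieldBits n ≤ (4 * (n * σ * y / x) + 1) * (5 * y) := by gcongr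
  have hT : (Nat.sqrt n : ℝ) * (superLen n * superLen n) * fieldBits n ≤
      Real.sqrt n * ((3 * x) * (3 * x)) * (5 * y) := by gcongr
  have hT' : Real.sqrt n * ((3 * x) * (3 * x)) * (5 * y) ≤ 45 * (Real.sqrt n * x ^ 3) := by
    have : Real.sqrt n * ((3 * x) * (3 * x)) * (5 * y) ≤
        Real.sqrt n * ((3 * x) * (3 * x)) * (5 * x) := by gcongr
    linarith
  have hx3 : x ≤ Real.sqrt n * x ^ 3 := by
    have h1 : x ≤ x ^ 3 := by nlinarith [sq_nonneg x]
    have h2 : 1 * x ^ 3 ≤ Real.sqrt n * x ^ 3 := by gcongr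
    linarith
  have e : (4 * (n * σ * y / x) + 1) * (5 * y) = 20 * (n * (σ / (x / y ^ 2))) + 5 * y := by
    field_simp
    ring
  rw [e] at hMV
  -- The constants are `100 = 5 * 20` and `184 = 38 * 3 + 5 * 5 + 45`.
  linarith

theorem tendsto_log_natCast : Tendsto (fun n : ℕ => Real.log n) atTop atTop :=
  Real.tendsto_log_atTop.comp tendsto_natCast_atTop_atTop

theorem tendsto_log_log_natCast : Tendsto (fun n : ℕ => Real.log (Real.log n)) atTop atTop :=
  Real.tendsto_log_atTop.comp tendsto_log_natCast

variable {σ : ℕ → ℕ}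

theorem eventually_le_log (hσ : (fun n : ℕ => (σ n : ℝ)) =o[atTop]
    fun n : ℕ => Real.log n / Real.log (Real.log n) ^ 2) :
    ∀ᶠ n : ℕ in atTop, (σ n : ℝ) ≤ Real.log n := by
  filter_upwards [hσ.bound one_pos, tendsto_log_natCast.eventually_ge_atTop 1,
    tendsto_log_log_natCast.eventually_ge_atTop 1] with n h1 h2 h3
  rw [one_mul, Real.norm_natCast, Real.norm_of_nonneg (by positivity)] at h1
  exact h1.trans (div_le_self (by linarith) (one_le_pow₀ h3))

theorem isLittleO_sqrt_mul_log_pow :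
    (fun n : ℕ => Real.sqrt n * Real.log n ^ 3) =o[atTop] fun n : ℕ => (n : ℝ) := by
  -- The exponent `1 / 6` is chosen so that its cube supplies the missing factor `√x`.
  have h1 : (fun x : ℝ => Real.log x ^ 3) =o[atTop] fun x : ℝ => (x ^ (1 / 6 : ℝ)) ^ 3 :=
    (isLittleO_log_rpow_atTop (by norm_num)).pow (by norm_num)
  have h2 : (fun x : ℝ => Real.sqrt x * Real.log x ^ 3) =o[atTop]
      fun x : ℝ => Real.sqrt x * (x ^ (1 / 6 : ℝ)) ^ 3 := (isBigO_refl _ _).mul_isLittleO h1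
  refine (h2.comp_tendsto tendsto_natCast_atTop_atTop).congr_right fun n => ?_
  have hn : (0 : ℝ) ≤ n := Nat.cast_nonneg n
  simp only [Function.comp]
  rw [← Real.rpow_natCast, ← Real.rpow_mul hn, show (1 / 6 * (3 : ℕ) : ℝ) = 1 / 2 by norm_num,
    ← Real.sqrt_eq_rpow, Real.mul_self_sqrt hn]

theorem isLittleO_extraLen (hσ : (fun n : ℕ => (σ n : ℝ)) =o[atTop]
    fun n : ℕ => Real.log n / Real.log (Real.log n) ^ 2) :
    (fun n : ℕ => (extraLen (σ n) n : ℝ)) =o[atTop] fun n : ℕ => (n : ℝ) := by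
  have h1 : (fun n : ℕ => (n : ℝ) * ((σ n : ℝ) / (Real.log n / Real.log (Real.log n) ^ 2)))
      =o[atTop] fun n : ℕ => (n : ℝ) := by
    simpa using (isBigO_refl (fun n : ℕ => (n : ℝ)) atTop).mul_isLittleO
      ((isLittleO_one_iff ℝ).2 hσ.tendsto_div_nhds_zero)
  have h2 := (h1.const_mul_left 100).add (isLittleO_sqrt_mul_log_pow.const_mul_left 184)
  refine IsBigO.trans_isLittleO (IsBigO.of_bound' ?_) h2
  filter_upwards [tendsto_log_natCast.eventually_ge_atTop 18, eventually_le_log hσ] with n h3 h4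
  rw [Real.norm_natCast]
  exact (extraLen_le_log h3 h4).trans (Real.le_norm_self _)

/-! ### Admissibility for large `n` -/

theorem two_mul_size_le {x : ℕ} (hx : 6 ≤ x) : 2 * Nat.size x ≤ x := by
  have key : ∀ q, 3 ≤ q → 2 * q + 1 < 2 ^ q := fun q hq => by
    induction q, hq using Nat.le_induction with
    | base => norm_num
    | succ q _ ih => rw [pow_succ]; omega
  have := Nat.size_le.2 (show x < 2 ^ (x / 2) by have := key (x / 2) (by omega); omega)
  omega

theorem sq_lt_two_pow_addrBits {n : ℕ} (hn : 2 ≤ n) : n ^ 2 < 8 * 2 ^ addrBits n := by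
  have hlog : 1 ≤ Nat.log 2 n := Nat.le_log_of_pow_le (by norm_num) (by omega)
  calc n ^ 2 < (2 ^ (Nat.log 2 n + 1)) ^ 2 :=
        Nat.pow_lt_pow_left (Nat.lt_pow_succ_log_self (by norm_num) n) (by norm_num)
    _ = 8 * 2 ^ addrBits n := by
        rw [← pow_mul, addrBits, show 8 = 2 ^ 3 by norm_num, ← pow_add]
        congr 1; omega

/-- Each of the two position tables has at most `2 * n` fields of at most `2 * superLen n` bits, so
`10 = 4 + 4 + 2`. -/
theorem codesAddr_le {σ n : ℕ} (hn : 1 ≤ n) :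
    codesAddr σ n + 2 * (n * superLen n) ≤ extraLen σ n + 10 * (n * superLen n) := by
  have hln : superLen n ≤ n := Nat.size_le.2 Nat.lt_two_pow_self
  have hn' : n < 2 ^ superLen n := Nat.lt_size_self n
  have hbits : ∀ x, x ≤ n → Nat.size (x * superLen n) ≤ 2 * superLen n := fun x hx => by
    rw [Nat.size_le, two_mul, pow_add]
    exact Nat.mul_lt_mul_of_lt_of_le (by omega) (by omega) (by omega)
  have hu : startBits n ≤ 2 * superLen n := hbits n le_rfl
  have hv : fieldBits n ≤ 2 * superLen n := hbits _ hln
  have hnb := numBlocks_le σ n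
  have hnb' : numBlocks σ n / superLen n ≤ n := (Nat.div_le_self _ _).trans hnb
  have h1 : (numBlocks σ n / superLen n + 1) * startBits n ≤ (2 * n) * (2 * superLen n) :=
    Nat.mul_le_mul (by omega) hu
  have h2 : (numBlocks σ n + 1) * fieldBits n ≤ (2 * n) * (2 * superLen n) :=
    Nat.mul_le_mul (by omega) hv
  have h3 : 2 * n * (2 * superLen n) = 4 * (n * superLen n) := by ring
  rw [codesAddr, blockAddr]
  omega

theorem eventually_admissible (hσ : (fun n : ℕ => (σ n : ℝ)) =o[atTop]
    fun n : ℕ => Real.log n / Real.log (Real.log n) ^ 2) :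
    ∀ᶠ n : ℕ in atTop, 1 ≤ σ n → Admissible (σ n) n := by
  have hlog : (fun n : ℕ => Real.log n) =o[atTop] fun n : ℕ => (n : ℝ) :=
    Real.isLittleO_log_id_atTop.comp_tendsto tendsto_natCast_atTop_atTop
  have hsq : (fun n : ℕ => Real.log n ^ 2) =o[atTop] fun n : ℕ => (n : ℝ) :=
    (Real.isLittleO_pow_log_id_atTop (n := 2)).comp_tendsto tendsto_natCast_atTop_atTop
  filter_upwards [eventually_le_log hσ, (isLittleO_extraLen hσ).bound one_pos,
    hlog.bound (show (0 : ℝ) < 1 / 300 by norm_num), hsq.bound one_pos,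
    tendsto_log_natCast.eventually_ge_atTop 18, eventually_ge_atTop 16] with
    n h1 h2 h3 h4 h5 h6 hσ1
  rw [Real.norm_natCast, Real.norm_natCast, one_mul] at h2
  rw [Real.norm_natCast, Real.norm_of_nonneg (by linarith)] at h3
  rw [Real.norm_natCast, Real.norm_of_nonneg (by positivity), one_mul] at h4
  -- Here `superLen n ≤ 3 * log n`, and `8 + 240 * log n ≤ 300 * log n ≤ n`; this is where `1 / 300`
  -- comes from.
  have hl : 8 + 80 * superLen n ≤ n := by
    have := superLen_le_log (n := n) (by linarith)
    have : (8 + 80 * superLen n : ℝ) ≤ n := by linarith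
    exact_mod_cast this
  have hlog4 : 4 ≤ Nat.log 2 n := Nat.le_log_of_pow_le (by norm_num) (by omega)
  refine ⟨hσ1, ?_, ?_, two_mul_size_le (by rw [addrBits]; omega), ?_⟩
  · have := h1.trans (log_lt_superLen (by omega)).le
    exact_mod_cast this
  · have hm : ((max 2 (σ n) : ℕ) : ℝ) ≤ Real.log n := by
      rw [Nat.cast_max]; exact max_le (by norm_num; linarith) h1
    have : ((max 2 (σ n) : ℕ) : ℝ) ^ 2 ≤ n := (by gcongr : _ ≤ Real.log n ^ 2).trans h4
    exact_mod_cast this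
  · have he : extraLen (σ n) n ≤ n := by exact_mod_cast h2
    have hc := codesAddr_le (σ := σ n) (n := n) (by omega)
    have hp := sq_lt_two_pow_addrBits (n := n) (by omega)
    -- The factor `8` matches `n ^ 2 < 8 * 2 ^ addrBits n`, the loss from rounding `2 * lg n` down
    -- to `addrBits n`.
    have : 8 * (n + 10 * (n * superLen n)) ≤ n ^ 2 :=
      calc 8 * (n + 10 * (n * superLen n)) = n * (8 + 80 * superLen n) := by ring
        _ ≤ n ^ 2 := by rw [sq]; exact Nat.mul_le_mul_left n hl
    omega

end SearchIndex

theorem lemma2 :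
    ∃ (P : WordRAM.Program) (T : ℕ),
      ∀ σ : ℕ → ℕ,
        (fun n : ℕ => (σ n : ℝ)) =o[atTop]
          (fun n : ℕ => Real.log n / (Real.log (Real.log n)) ^ 2) →
        ∃ e : ℕ → ℕ, (fun n : ℕ => (e n : ℝ)) =o[atTop] (fun n : ℕ => (n : ℝ)) ∧
          ∀ᶠ n : ℕ in atTop, ∀ S : List ℕ, S.length = n → (∀ x ∈ S, 1 ≤ x ∧ x ≤ σ n) →
            ∃ extra : List Bool, extra.length ≤ e n ∧
              ∀ w : ℕ, n ^ 2 ≤ 2 ^ w → ∀ j < 2 ^ w,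
                WordRAM.Computes w (extra ++ FerraginaVenturini.representation (σ n) S) P j T
                  (PartialSums.search S j) := by
  refine ⟨SearchIndex.query, SearchIndex.queryCode.length + 1, fun σ hσ =>
    ⟨fun n => SearchIndex.extraLen (σ n) n, SearchIndex.isLittleO_extraLen hσ, ?_⟩⟩
  filter_upwards [SearchIndex.eventually_admissible hσ, eventually_ge_atTop 1] with n hn hn1 S hS hx
  subst hS
  -- The growth condition allows `σ n = 0`, but then no nonempty sequence over the alphabet exists.
  have hσ1 : 1 ≤ σ S.length := by
    obtain ⟨x, hxS⟩ := List.exists_mem_of_length_pos hn1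
    exact (hx x hxS).1.trans (hx x hxS).2
  exact ⟨SearchIndex.extra (σ S.length) S, (SearchIndex.length_extra _ S).le, fun w hw j hj =>
    SearchIndex.computes_query (hn hσ1) hx hw hj⟩
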